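/- Conventions. For $r>0$ let $\mathbb S^{15}_r=\{x\in\mathbb R^{16}\mid \langle x,x\rangle=r\}$, with its rotation-invariant probability measure $\sigma$, and $\mathbb S^{15}=\mathbb S^{15}_1$. A cubature formula of strength $t$ on $\mathbb S^{15}_r$ is a pair $(X,W)$, where $X\subset\mathbb S^{15}_r$ is finite and $W$ is a positive function on $X$, such that $\sum_{x\in X}W(x)f(x)=\int_{\mathbb S^{15}_r} f\,d\sigma$ for every polynomial function $f:\mathbb R^{16}\to\mathbb C$ of degree at most $t$; its size is $|X|$. A spherical $t$-design on $\mathbb S^{15}_r$ is a finite set $X\subset\mathbb S^{15}_r$ which, with the constant weight $1/|X|$, is a cubature formula of strength $t$. For $E\subset\mathbb R^{16}$ and $m>0$ let $E_m=\{x\in E\mid\langle x,x\rangle=m\}$; the shells of $E$ are the non-empty sets $E_m$ with $m>0$. We say that the shells $m_1,\dots,m_k$ of $E$ combine to a cubature formula of strength $t$ if, with $X_j=\frac1{\sqrt{m_j}}E_{m_j}\subset\mathbb S^{15}$ and $X=X_1\cup\dots\cup X_k$, there are real numbers $w_1,\dots,w_k>0$ such that $X$ with the weight $W(x)=\sum_{j:\,x\in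 X_j}w_j$ is a cubature formula of strength $t$ on $\mathbb S^{15}$; its size is $|X|$. Let $BW_{16}\subset\mathbb R^{16}$ be the Barnes–Wall lattice: the set of vectors $\frac1{\sqrt2}x$ with $x\in\mathbb Z^{16}$, $x \bmod 2$ in the first order Reed–Muller code of length $16$, and $\sum_i x_i\equiv0\pmod 4$. Let $BW_{16}'=\sqrt2\,BW_{16}^*$, where $BW_{16}^*=\{y\in\mathbb R^{16}\mid\langle y,x\rangle\in\mathbb Z\text{ for all }x\in BW_{16}\}$. Theorem. 1. Every shell $(BW_{16})_m$ is a spherical $7$-design on $\mathbb S^{15}_m$; the shell $m=4$ has size $4\,320$. 2. The shells $4,6$ of $BW_{16}$ combine to a cubature formula of strength $9$ and size $65\,760$. 3. The shells $4,6$ of $BW_{16}\cup BW_{16}'$ combine to a cubature formula of strength $11$ and size $131\,520$. 4. The shells $4,6,10$ of $BW_{16}\cup BW_{16}'$ combine to a cubature formula of strength $13$ and size $4\,555\,200$. -/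

import Mathlib

open MeasureTheory
open scoped Pointwise

noncomputable section

namespace SphericalCubature

/-! ### Cubature formulas and designs on Euclidean spheres -/

/-- The sphere of equation `⟪x, x⟫ = r` in `ℝⁿ`; its radius is `√r`. -/
def normSphere (n : ℕ) (r : ℝ) : Set (EuclideanSpace ℝ (Fin n)) :=
  {x | inner ℝ x x = r}

/-- The rotation-invariant measure of total mass `1` on the sphere `⟪x, x⟫ = r` (for `n ≥ 1` and
`r > 0`), seen as a measure on `ℝⁿ`: the surface measure of the unit sphere, normalised and
transported by `u ↦ √r u`. -/
def sphereMeasure (n : ℕ) (r : ℝ) : Measure (EuclideanSpace ℝ (Fin n)) :=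
  Measure.map
    (fun u : Metric.sphere (0 : EuclideanSpace ℝ (Fin n)) 1 =>
      √r • (u : EuclideanSpace ℝ (Fin n)))
    (((volume : Measure (EuclideanSpace ℝ (Fin n))).toSphere Set.univ)⁻¹ •
      (volume : Measure (EuclideanSpace ℝ (Fin n))).toSphere)

/-- The value at a real point `x` of a polynomial with complex coefficients. -/
def polyValue {n : ℕ} (p : MvPolynomial (Fin n) ℂ) (x : EuclideanSpace ℝ (Fin n)) : ℂ :=
  MvPolynomial.eval (fun i => ((x i : ℝ) : ℂ)) p

/-- `(X, W)` is a cubature formula of strength `t` on the sphere `⟪x, x⟫ = r` in `ℝⁿ`. Only the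
values of `W` on `X` matter. -/
structure IsCubatureFormula {n : ℕ} (t : ℕ) (r : ℝ) (X : Set (EuclideanSpace ℝ (Fin n)))
    (W : EuclideanSpace ℝ (Fin n) → ℝ) : Prop where
  finite : X.Finite
  subset_sphere : X ⊆ normSphere n r
  weight_pos : ∀ x ∈ X, 0 < W x
  sum_eq_integral : ∀ p : MvPolynomial (Fin n) ℂ, p.totalDegree ≤ t →
    ∑ᶠ x ∈ X, (W x : ℂ) * polyValue p x = ∫ x, polyValue p x ∂(sphereMeasure n r)

/-- A spherical `t`-design on the sphere `⟪x, x⟫ = r`: the constant weight `|X|⁻¹` gives a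
cubature formula of strength `t`. The empty set is never a design (take a constant polynomial). -/
def IsSphericalDesign {n : ℕ} (t : ℕ) (r : ℝ) (X : Set (EuclideanSpace ℝ (Fin n))) : Prop :=
  IsCubatureFormula t r X (fun _ => (X.ncard : ℝ)⁻¹)

/-! ### Shells, and cubature formulas supported by several shells -/

/-- The shell `E_m = {x ∈ E | ⟪x, x⟫ = m}`. -/
def shell {n : ℕ} (E : Set (EuclideanSpace ℝ (Fin n))) (m : ℝ) :
    Set (EuclideanSpace ℝ (Fin n)) :=
  E ∩ normSphere n m

/-- The rescaled shell `(1/√m) E_m`, a subset of the unit sphere when `m > 0`. -/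
def unitShell {n : ℕ} (E : Set (EuclideanSpace ℝ (Fin n))) (m : ℝ) :
    Set (EuclideanSpace ℝ (Fin n)) :=
  (√m)⁻¹ • shell E m

/-- The union of the rescaled shells `(1/√m_j) E_{m_j}`. -/
def shellSupport {n k : ℕ} (E : Set (EuclideanSpace ℝ (Fin n))) (m : Fin k → ℝ) :
    Set (EuclideanSpace ℝ (Fin n)) :=
  ⋃ j, unitShell E (m j)

/-- The weight function `W(x) = ∑_{j : x ∈ X_j} w_j`, where `X_j = (1/√m_j) E_{m_j}`. -/
def shellWeight {n k : ℕ} (E : Set (EuclideanSpace ℝ (Fin n))) (m w : Fin k → ℝ)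
    (x : EuclideanSpace ℝ (Fin n)) : ℝ :=
  ∑ j, (unitShell E (m j)).indicator (fun _ => w j) x

/-- The shells `E_{m_1}, …, E_{m_k}` combine to a cubature formula of strength `t` on the unit
sphere, with one positive coefficient per shell. -/
def ShellsCombine {n k : ℕ} (t : ℕ) (E : Set (EuclideanSpace ℝ (Fin n))) (m : Fin k → ℝ) : Prop :=
  ∃ w : Fin k → ℝ, (∀ j, 0 < w j) ∧
    IsCubatureFormula t 1 (shellSupport E m) (shellWeight E m w)

/-! ### The Barnes-Wall lattice -/

/-- The dual lattice `Λ* = {y | ⟪y, x⟫ ∈ ℤ for all x ∈ Λ}`. -/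
def dualLattice {n : ℕ} (Λ : Submodule ℤ (EuclideanSpace ℝ (Fin n))) :
    Submodule ℤ (EuclideanSpace ℝ (Fin n)) :=
  LinearMap.BilinForm.dualSubmodule (innerₗ (EuclideanSpace ℝ (Fin n))) Λ

/-- The first order Reed-Muller code of length `16`, a binary `[16, 5, 8]` code: it is spanned by
the all-one word and the four words listing the binary digits of the positions `0, …, 15`. -/
def reedMuller : Submodule (ZMod 2) (Fin 16 → ZMod 2) :=
  Submodule.span (ZMod 2)
    (insert 1 (Set.range fun (k : Fin 4) (i : Fin 16) => (((i : ℕ) / 2 ^ (k : ℕ) : ℕ) : ZMod 2)))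

/-- The Barnes-Wall lattice `BW₁₆`: the vectors `x / √2` of `ℝ¹⁶`, where `x` runs over the integral
vectors whose reduction modulo `2` is in the Reed-Muller code and whose coordinate sum is
divisible by `4`. -/
def barnesWall : Submodule ℤ (EuclideanSpace ℝ (Fin 16)) where
  carrier := {v | ∃ x : Fin 16 → ℤ, (fun i => (x i : ZMod 2)) ∈ reedMuller ∧
    4 ∣ ∑ i, x i ∧ ∀ i, v i = (x i : ℝ) / √2}
  zero_mem' := ⟨0, by convert reedMuller.zero_mem using 1; ext i; simp, by simp, by simp⟩
  add_mem' := by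
    rintro a b ⟨x, hx, hx4, hxa⟩ ⟨y, hy, hy4, hyb⟩
    refine ⟨x + y, ?_, ?_, fun i => ?_⟩
    · convert reedMuller.add_mem hx hy using 1
      ext i
      simp
    · simpa [Finset.sum_add_distrib] using dvd_add hx4 hy4
    · simp [hxa i, hyb i, add_div]
  smul_mem' := by
    rintro c a ⟨x, hx, hx4, hxa⟩
    refine ⟨c • x, ?_, ?_, fun i => ?_⟩
    · convert reedMuller.smul_mem (c : ZMod 2) hx using 1
      ext i
      simp
    · simpa [← Finset.mul_sum] using hx4.mul_left c
    · simp [hxa i, mul_div_assoc]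

/-- The set of vectors of `BW₁₆`. -/
def BW : Set (EuclideanSpace ℝ (Fin 16)) := barnesWall

/-- The rescaled dual `BW₁₆' = √2 BW₁₆*`. -/
def BW' : Set (EuclideanSpace ℝ (Fin 16)) :=
  √2 • (dualLattice barnesWall : Set (EuclideanSpace ℝ (Fin 16)))

end SphericalCubature

end

/-!
The sphere enters through its moments only. By rotation invariance `∫ ⟪x, y⟫ ^ 2k` is a multiple of
`⟪y, y⟫ ^ k`, and comparing coefficients in `y` gives the integrals of all monomials of degree `2k`
up to a common factor. A weighted finite set which is symmetric about the origin integrates odd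
monomials correctly, and even monomials of degree less than `2k` reduce to degree `2k` by
multiplication with powers of `⟪x, x⟫`. So strength `2k + 1` amounts to the proportionality of the
moments of degree `2k` to those of the sphere (`isCubatureFormula_of_moments`). The theorem is thus
a statement about the moments of degree `6` of all shells of the Barnes-Wall lattice and about those
of degrees `8`, `10`, `12` of a few short shells.

In integral coordinates the lattice and its rescaled dual are given by congruences (`IsBW` and
`IsBWDual`), which are invariant under the affine shears of the `16` positions. A moment vanishes
unless the parities of its exponent form a word of the Reed-Muller code, and the exponents which
remain fall into few orbits under the shears (`forall_exponents`).

In degree `6` there are three orbits. The lattice is also invariant under the isometry which acts by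
half of a Hadamard matrix on four blocks of four positions. Expanding the image of two monomials
under this isometry gives two linear relations between the three moments, which force
proportionality to the sphere for every shell (`moment_six`).

For the short shells the congruences are expressed by characters with values `±1` and residues
modulo `2`, so that a moment becomes a coefficient of a sum of `64` products of sixteen one-variable
generating functions. These are evaluated by Kronecker substitution, at a large power of `2`, and
the coefficients are read off as digits (`two_mul_moment_eq`, `thirtytwo_mul_moment_eq`). The
required relations between the moments are then finitely many numerical identities
(`shortMoment_eq`), and the moments of degree `0` give the numbers of points. Normalized shells are
disjoint when the product of their integral norms is not a square (`disjoint_scaledShell`).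
-/

noncomputable section

namespace SphericalCubature

section

open MvPolynomial

/-! ### Functionals of sphere type on polynomials -/

/-- `(2b)! / b!` at an even number `2b` and `0` at an odd one: up to a factor which depends on the
degree only, the product of these numbers over the exponents is the integral of a monomial over a
sphere. -/
def evenFactor (e : ℕ) : ℕ := if Even e then e.factorial / (e / 2).factorial else 0

/-- The polynomial `X₁² + ⋯ + Xₙ²`. -/
def normSqPoly (n : ℕ) : MvPolynomial (Fin n) ℝ := ∑ i, X i ^ 2

/-- The properties shared by integration over the sphere `⟪x, x⟫ = r` and by an antipodal cubature
formula of strength `2k + 1` on that sphere. -/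
structure IsSphereFunctional {n : ℕ} (r : ℝ) (k : ℕ) (L : MvPolynomial (Fin n) ℝ →ₗ[ℝ] ℝ) :
    Prop where
  map_one : L 1 = 1
  map_mul_normSq : ∀ p, L (p * normSqPoly n) = r * L p
  map_odd : ∀ a : Fin n →₀ ℕ, Odd a.degree → L (monomial a 1) = 0
  exists_map_eq : ∃ c : ℝ, ∀ a : Fin n →₀ ℕ, a.degree = 2 * k →
    L (monomial a 1) = c * ∏ i, (evenFactor (a i) : ℝ)

lemma normSqPoly_pow_isHomogeneous (n l : ℕ) : (normSqPoly n ^ l).IsHomogeneous (2 * l) := by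
  have h : (normSqPoly n).IsHomogeneous 2 := by
    refine IsHomogeneous.sum _ _ _ fun i _ => ?_
    simpa using (isHomogeneous_X ℝ i).pow 2
  exact h.pow l

lemma eq_of_isHomogeneous {n d : ℕ} {L L' : MvPolynomial (Fin n) ℝ →ₗ[ℝ] ℝ}
    (h : ∀ a : Fin n →₀ ℕ, a.degree = d → L (monomial a 1) = L' (monomial a 1))
    {p : MvPolynomial (Fin n) ℝ} (hp : p.IsHomogeneous d) : L p = L' p := by
  rw [p.as_sum, map_sum, map_sum]
  refine Finset.sum_congr rfl fun a ha => ?_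
  have h1 : monomial a (coeff a p) = coeff a p • monomial a (1 : ℝ) := by
    rw [smul_monomial, smul_eq_mul, mul_one]
  have hd : a.degree = d := by
    rw [Finsupp.degree_eq_weight_one (R := ℕ)]
    exact hp (mem_support_iff.1 ha)
  rw [h1, map_smul, map_smul, h a hd]

lemma IsSphereFunctional.map_mul_normSq_pow {n : ℕ} {r : ℝ} {k : ℕ}
    {L : MvPolynomial (Fin n) ℝ →ₗ[ℝ] ℝ} (hL : IsSphereFunctional r k L)
    (p : MvPolynomial (Fin n) ℝ) (l : ℕ) : L (p * normSqPoly n ^ l) = r ^ l * L p := by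
  induction l with
  | zero => simp
  | succ l ih => rw [pow_succ, ← mul_assoc, hL.map_mul_normSq, ih]; ring

/-- In degree `2k` such a functional is determined up to a constant, which is fixed by the value at
`(X₁² + ⋯ + Xₙ²)ᵏ`; smaller even degrees follow by multiplying with powers of
`X₁² + ⋯ + Xₙ²`. -/
theorem IsSphereFunctional.eq_monomial {n : ℕ} {r : ℝ} (hr : r ≠ 0) {k : ℕ}
    {L L' : MvPolynomial (Fin n) ℝ →ₗ[ℝ] ℝ} (hL : IsSphereFunctional r k L)
    (hL' : IsSphereFunctional r k L') (a : Fin n →₀ ℕ) (ha : a.degree ≤ 2 * k + 1) :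
    L (monomial a 1) = L' (monomial a 1) := by
  obtain ⟨c, hc⟩ := hL.exists_map_eq
  obtain ⟨c', hc'⟩ := hL'.exists_map_eq
  let S : MvPolynomial (Fin n) ℝ →ₗ[ℝ] ℝ :=
    (basisMonomials (Fin n) ℝ).constr ℝ fun a => ∏ i, (evenFactor (a i) : ℝ)
  have hS : ∀ a : Fin n →₀ ℕ, S (monomial a 1) = ∏ i, (evenFactor (a i) : ℝ) := fun a => by
    have := (basisMonomials (Fin n) ℝ).constr_basis ℝ
      (fun a => ∏ i, (evenFactor (a i) : ℝ)) a
    simpa using this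
  have e1 : ∀ p : MvPolynomial (Fin n) ℝ, p.IsHomogeneous (2 * k) → L p = c * S p := fun p hp =>
    eq_of_isHomogeneous (L' := c • S) (fun a ha => by simp [hc a ha, hS]) hp
  have e2 : ∀ p : MvPolynomial (Fin n) ℝ, p.IsHomogeneous (2 * k) → L' p = c' * S p := fun p hp =>
    eq_of_isHomogeneous (L' := c' • S) (fun a ha => by simp [hc' a ha, hS]) hp
  have n1 := hL.map_mul_normSq_pow 1 k
  have n2 := hL'.map_mul_normSq_pow 1 k
  rw [one_mul, hL.map_one, e1 _ (normSqPoly_pow_isHomogeneous n k)] at n1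
  rw [one_mul, hL'.map_one, e2 _ (normSqPoly_pow_isHomogeneous n k)] at n2
  have hrk : r ^ k ≠ 0 := pow_ne_zero _ hr
  have hcc : c = c' := by
    have h0 : S (normSqPoly n ^ k) ≠ 0 := by
      intro h0
      rw [h0] at n1
      exact hrk (by simpa using n1.symm)
    exact mul_right_cancel₀ h0 (n1.trans n2.symm)
  rcases Nat.even_or_odd a.degree with he | ho
  · obtain ⟨l, hl⟩ := he
    have hlk : l ≤ k := by omega
    have hom : (monomial a (1 : ℝ) * normSqPoly n ^ (k - l)).IsHomogeneous (2 * k) := by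
      have := (isHomogeneous_monomial (n := a.degree) (1 : ℝ) rfl).mul
        (normSqPoly_pow_isHomogeneous n (k - l))
      convert this using 1
      omega
    have := hL.map_mul_normSq_pow (monomial a 1) (k - l)
    rw [e1 _ hom, hcc, ← e2 _ hom, hL'.map_mul_normSq_pow] at this
    exact (mul_left_cancel₀ (pow_ne_zero _ hr) this).symm
  · rw [hL.map_odd a ho, hL'.map_odd a ho]

/-! ### The measure on the sphere -/

lemma toSphere_isometry_preimage {n : ℕ}
    (U : EuclideanSpace ℝ (Fin n) ≃ₗᵢ[ℝ] EuclideanSpace ℝ (Fin n))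
    (s : Set (Metric.sphere (0 : EuclideanSpace ℝ (Fin n)) 1)) (hs : MeasurableSet s)
    (s' : Set (Metric.sphere (0 : EuclideanSpace ℝ (Fin n)) 1)) (hs' : MeasurableSet s')
    (h : ((↑) '' s' : Set (EuclideanSpace ℝ (Fin n))) = U ⁻¹' ((↑) '' s)) :
    (volume : Measure (EuclideanSpace ℝ (Fin n))).toSphere s' =
      (volume : Measure (EuclideanSpace ℝ (Fin n))).toSphere s := by
  rw [Measure.toSphere_apply' _ hs, Measure.toSphere_apply' _ hs', h]
  congr 1
  have : Set.Ioo (0 : ℝ) 1 • (U ⁻¹' ((↑) '' s) : Set (EuclideanSpace ℝ (Fin n))) =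
      U ⁻¹' (Set.Ioo (0 : ℝ) 1 • ((↑) '' s)) := by
    ext x
    simp only [Set.mem_smul, Set.mem_preimage]
    constructor
    · rintro ⟨t, ht, y, hy, rfl⟩
      exact ⟨t, ht, U y, hy, by simp⟩
    · rintro ⟨t, ht, y, hy, hxy⟩
      refine ⟨t, ht, U.symm y, by simpa using hy, ?_⟩
      rw [← map_smul, hxy]; simp
  rw [this]
  exact U.measurePreserving.measure_preimage_equiv (f := U.toMeasurableEquiv) _

lemma measurable_sphere_smul (n : ℕ) (r : ℝ) :
    Measurable (fun u : Metric.sphere (0 : EuclideanSpace ℝ (Fin n)) 1 =>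
      √r • (u : EuclideanSpace ℝ (Fin n))) :=
  (continuous_subtype_val.const_smul (√r)).measurable

lemma sphereMeasure_map_isometry {n : ℕ} (r : ℝ)
    (U : EuclideanSpace ℝ (Fin n) ≃ₗᵢ[ℝ] EuclideanSpace ℝ (Fin n)) :
    (sphereMeasure n r).map U = sphereMeasure n r := by
  have hU : Measurable U := U.continuous.measurable
  ext s hs
  rw [Measure.map_apply hU hs]
  unfold sphereMeasure
  rw [Measure.map_apply (measurable_sphere_smul n r) hs,
    Measure.map_apply (measurable_sphere_smul n r) (hU hs), Measure.smul_apply, Measure.smul_apply]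
  congr 1
  refine toSphere_isometry_preimage U _ (measurable_sphere_smul n r hs) _
    (measurable_sphere_smul n r (hU hs)) ?_
  ext x
  simp only [Set.mem_image, Set.mem_preimage, Subtype.exists, mem_sphere_iff_norm, sub_zero,
    exists_and_left, exists_prop, exists_eq_right_right]
  simp

instance isProbabilityMeasure_sphereMeasure (n : ℕ) [NeZero n] (r : ℝ) :
    IsProbabilityMeasure (sphereMeasure n r) := by
  have h0 : (volume : Measure (EuclideanSpace ℝ (Fin n))).toSphere Set.univ ≠ 0 := by
    rw [Ne, Measure.measure_univ_eq_zero]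
    exact Measure.toSphere_ne_zero _
  constructor
  unfold sphereMeasure
  rw [Measure.map_apply (measurable_sphere_smul n r) .univ, Set.preimage_univ, Measure.smul_apply,
    smul_eq_mul, ENNReal.inv_mul_cancel h0 (measure_ne_top _ _)]

lemma ae_sphereMeasure (n : ℕ) {r : ℝ} (hr : 0 ≤ r) :
    ∀ᵐ x ∂(sphereMeasure n r), x ∈ normSphere n r := by
  have hm : MeasurableSet (normSphere n r) := by
    have : Continuous fun x : EuclideanSpace ℝ (Fin n) => (inner ℝ x x : ℝ) := by fun_prop
    exact (isClosed_singleton.preimage this).measurableSet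
  unfold sphereMeasure
  refine (ae_map_iff (measurable_sphere_smul n r).aemeasurable hm).2 ?_
  refine Filter.Eventually.of_forall fun u => ?_
  have hu : ‖(u : EuclideanSpace ℝ (Fin n))‖ = 1 := by simp
  change inner ℝ (√r • (u : EuclideanSpace ℝ (Fin n))) (√r • (u : EuclideanSpace ℝ (Fin n))) = r
  rw [real_inner_self_eq_norm_sq, norm_smul, hu, mul_one, Real.norm_eq_abs, sq_abs, Real.sq_sqrt hr]

lemma integrable_sphereMeasure {n : ℕ} [NeZero n] {r : ℝ} (hr : 0 ≤ r)
    {f : EuclideanSpace ℝ (Fin n) → ℝ} (hf : Continuous f) :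
    Integrable f (sphereMeasure n r) := by
  obtain ⟨K, hK⟩ := (isCompact_closedBall (0 : EuclideanSpace ℝ (Fin n))
    (√r)).exists_bound_of_continuousOn hf.continuousOn
  refine Integrable.of_bound hf.aestronglyMeasurable K ?_
  filter_upwards [ae_sphereMeasure n hr] with x hx
  refine hK x ?_
  rw [mem_closedBall_zero_iff]
  refine Real.le_sqrt_of_sq_le ?_
  rw [← real_inner_self_eq_norm_sq]
  exact le_of_eq hx

lemma integral_comp_isometry {n : ℕ} (r : ℝ)
    (U : EuclideanSpace ℝ (Fin n) ≃ₗᵢ[ℝ] EuclideanSpace ℝ (Fin n))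
    (f : EuclideanSpace ℝ (Fin n) → ℝ) :
    ∫ x, f (U x) ∂(sphereMeasure n r) = ∫ x, f x ∂(sphereMeasure n r) := by
  conv_rhs => rw [← sphereMeasure_map_isometry r U]
  exact (integral_map_equiv U.toMeasurableEquiv f).symm

/-! ### The moments of the sphere -/

/-- The value at `x` of a polynomial with real coefficients. -/
def realValue {n : ℕ} (x : EuclideanSpace ℝ (Fin n)) (p : MvPolynomial (Fin n) ℝ) : ℝ :=
  eval (fun i => x i) p

lemma continuous_realValue {n : ℕ} (p : MvPolynomial (Fin n) ℝ) :
    Continuous fun x : EuclideanSpace ℝ (Fin n) => realValue x p := by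
  have h : Continuous fun x : EuclideanSpace ℝ (Fin n) => fun i => x i := by fun_prop
  exact (continuous_eval p).comp h

lemma realValue_monomial {n : ℕ} (x : EuclideanSpace ℝ (Fin n)) (a : Fin n →₀ ℕ) :
    realValue x (monomial a 1) = ∏ i, x i ^ a i := by
  rw [realValue, eval_monomial, one_mul, Finsupp.prod_fintype _ _ (by simp)]

lemma realValue_normSqPoly {n : ℕ} (x : EuclideanSpace ℝ (Fin n)) :
    realValue x (normSqPoly n) = inner ℝ x x := by
  simp [realValue, normSqPoly, EuclideanSpace.real_norm_sq_eq]

lemma realValue_neg_monomial {n : ℕ} (x : EuclideanSpace ℝ (Fin n)) (a : Fin n →₀ ℕ)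
    (ha : Odd a.degree) : realValue (-x) (monomial a 1) = -realValue x (monomial a 1) := by
  rw [realValue_monomial, realValue_monomial]
  have : ∀ i, (-x) i ^ a i = (-1) ^ a i * x i ^ a i := fun i => by
    rw [PiLp.neg_apply, neg_pow]
  rw [Finset.prod_congr rfl fun i _ => this i, Finset.prod_mul_distrib, Finset.prod_pow_eq_pow_sum,
    ← Finsupp.degree_eq_sum, ha.neg_one_pow, neg_one_mul]

/-- Integration of polynomials over the sphere. -/
def sphereFunctional (n : ℕ) [NeZero n] {r : ℝ} (hr : 0 ≤ r) : MvPolynomial (Fin n) ℝ →ₗ[ℝ] ℝ where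
  toFun p := ∫ x, realValue x p ∂(sphereMeasure n r)
  map_add' p q := by
    rw [← integral_add (integrable_sphereMeasure hr (continuous_realValue p))
      (integrable_sphereMeasure hr (continuous_realValue q))]
    simp [realValue]
  map_smul' c p := by
    simp [realValue, smul_eval, integral_const_mul]

/-- By rotation invariance the integral of a power of a linear form only depends on the norm of the
form. -/
lemma integral_inner_pow {n : ℕ} [NeZero n] (r : ℝ) (k : ℕ) (y : EuclideanSpace ℝ (Fin n)) :
    ∫ x, (inner ℝ x y) ^ (2 * k) ∂(sphereMeasure n r) =
      (∫ x : EuclideanSpace ℝ (Fin n), x 0 ^ (2 * k) ∂(sphereMeasure n r)) * (inner ℝ y y) ^ k := by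
  let v : EuclideanSpace ℝ (Fin n) := ‖y‖ • EuclideanSpace.single 0 1
  have hv : ‖y‖ = ‖v‖ := by simp [v, norm_smul]
  let U := (Submodule.span ℝ {y - v})ᗮ.reflection
  have hU : U y = v := Submodule.reflection_sub hv
  have h1 : ∀ x, (inner ℝ x y : ℝ) ^ (2 * k) = (inner ℝ y y) ^ k * (U x) 0 ^ (2 * k) := fun x => by
    rw [← U.inner_map_map x y, hU, real_inner_self_eq_norm_sq]
    simp only [v, inner_smul_right, EuclideanSpace.inner_single_right]
    simp [mul_pow, pow_mul]
  simp_rw [h1, integral_const_mul]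
  rw [integral_comp_isometry r U (fun x => x 0 ^ (2 * k)), mul_comm]

/-- The moments of degree `2k` of the sphere: compare the coefficients, as polynomials in `y`, of
the two sides of `∫ ⟪x, y⟫²ᵏ = c ⟪y, y⟫ᵏ`. -/
lemma exists_sphere_moment_eq {n : ℕ} [NeZero n] {r : ℝ} (hr : 0 ≤ r) (k : ℕ) :
    ∃ c : ℝ, ∀ a : Fin n →₀ ℕ, a.degree = 2 * k →
      sphereFunctional n hr (monomial a 1) = c * ∏ i, (evenFactor (a i) : ℝ) := by
  classical
  set c₀ := ∫ x : EuclideanSpace ℝ (Fin n), x 0 ^ (2 * k) ∂(sphereMeasure n r) with hc₀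
  let F : (Fin n → ℕ) → (Fin n →₀ ℕ) := Finsupp.equivFunOnFinite.symm
  have hF : Function.Injective F := Finsupp.equivFunOnFinite.symm.injective
  let P : MvPolynomial (Fin n) ℝ := ∑ a ∈ Finset.univ.piAntidiag (2 * k),
    monomial (F a) (Nat.multinomial Finset.univ a * sphereFunctional n hr (monomial (F a) 1))
  let Q : MvPolynomial (Fin n) ℝ := ∑ b ∈ Finset.univ.piAntidiag k,
    monomial (F (2 • b)) (c₀ * Nat.multinomial Finset.univ b)
  have hPQ : P = Q := by
    refine MvPolynomial.funext fun y => ?_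
    have hy := integral_inner_pow r k (WithLp.toLp 2 y)
    have h1 : ∀ x : EuclideanSpace ℝ (Fin n), (inner ℝ x (WithLp.toLp 2 y)) ^ (2 * k) =
        ∑ a ∈ Finset.univ.piAntidiag (2 * k), (Nat.multinomial Finset.univ a * ∏ i, y i ^ a i) *
          realValue x (monomial (F a) 1) := fun x => by
      rw [PiLp.inner_apply, Finset.sum_pow_eq_sum_piAntidiag]
      refine Finset.sum_congr rfl fun a _ => ?_
      rw [realValue_monomial, mul_assoc, ← Finset.prod_mul_distrib]
      simp [F, mul_pow]
    have h2 : (inner ℝ (WithLp.toLp 2 y) (WithLp.toLp 2 y) : ℝ) ^ k =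
        ∑ b ∈ Finset.univ.piAntidiag k, (Nat.multinomial Finset.univ b : ℝ) *
          ∏ i, y i ^ (2 * b i) := by
      rw [PiLp.inner_apply, Finset.sum_pow_eq_sum_piAntidiag]
      refine Finset.sum_congr rfl fun a _ => ?_
      simp [← pow_mul]
    simp_rw [h1] at hy
    rw [integral_finsetSum _ fun a _ =>
      (integrable_sphereMeasure hr (continuous_realValue _)).const_mul _, h2, ← hc₀] at hy
    simp_rw [integral_const_mul] at hy
    simp only [P, Q, map_sum, eval_monomial]
    rw [Finset.mul_sum] at hy
    convert hy using 2 with a _ b _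
    · rw [Finsupp.prod_fintype _ _ (by simp)]
      simp only [F, sphereFunctional, LinearMap.coe_mk, AddHom.coe_mk,
        Finsupp.coe_equivFunOnFinite_symm]
      ring
    · rw [Finsupp.prod_fintype _ _ (by simp)]
      simp only [F, Finsupp.coe_equivFunOnFinite_symm, Pi.smul_apply, smul_eq_mul]
      ring
  refine ⟨c₀ * k.factorial / (2 * k).factorial, fun a ha => ?_⟩
  have haF : F a = a := Finsupp.equivFunOnFinite.symm_apply_apply a
  have hsum : ∑ i, a i = 2 * k := by rw [← ha, Finsupp.degree_eq_sum]
  have hmem : (a : Fin n → ℕ) ∈ Finset.univ.piAntidiag (2 * k) := by simp [hsum]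
  have hPa : coeff a P = Nat.multinomial Finset.univ a * sphereFunctional n hr (monomial a 1) := by
    simp only [P, coeff_sum, coeff_monomial]
    rw [Finset.sum_eq_single_of_mem _ hmem, if_pos haF, haF]
    intro b _ hb
    exact if_neg fun h => hb (hF (h.trans haF.symm))
  have hm1 := Nat.multinomial_spec Finset.univ a
  rw [hsum] at hm1
  have hm1' : (∏ i, ((a i).factorial : ℝ)) * Nat.multinomial Finset.univ a = (2 * k).factorial := by
    exact_mod_cast hm1
  have hk2 : ((2 * k).factorial : ℝ) ≠ 0 := by positivity
  by_cases hev : ∀ i, Even (a i)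
  · let b : Fin n → ℕ := fun i => a i / 2
    have hb2 : ∀ i, a i = 2 * b i := fun i => (Nat.mul_div_cancel' (hev i).two_dvd).symm
    have hbs : ∑ i, b i = k := by
      have : 2 * ∑ i, b i = 2 * k := by rw [Finset.mul_sum, ← hsum]; simp_rw [hb2]
      omega
    have hbF : F (2 • b) = a := by
      rw [← haF]; congr 1; ext i; simp [hb2 i]
    have hQa : coeff a Q = c₀ * Nat.multinomial Finset.univ b := by
      simp only [Q, coeff_sum, coeff_monomial]
      rw [Finset.sum_eq_single_of_mem b (by simp [hbs]), if_pos hbF]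
      intro b' _ hb'
      refine if_neg fun h => hb' ?_
      have := hF (h.trans hbF.symm)
      ext i
      have := congrFun this i
      simpa using this
    have hm2 := Nat.multinomial_spec Finset.univ b
    rw [hbs] at hm2
    have hm2' : (∏ i, ((b i).factorial : ℝ)) * Nat.multinomial Finset.univ b = k.factorial := by
      exact_mod_cast hm2
    have hg : (∏ i, (evenFactor (a i) : ℝ)) * ∏ i, ((b i).factorial : ℝ) =
        ∏ i, ((a i).factorial : ℝ) := by
      rw [← Finset.prod_mul_distrib]
      refine Finset.prod_congr rfl fun i _ => ?_
      rw [evenFactor, if_pos (hev i)]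
      have hdvd : (b i).factorial ∣ (a i).factorial := Nat.factorial_dvd_factorial (by
        have := hb2 i; omega)
      exact_mod_cast Nat.div_mul_cancel hdvd
    have key : (Nat.multinomial Finset.univ a : ℝ) * sphereFunctional n hr (monomial a 1) =
        c₀ * Nat.multinomial Finset.univ b := by rw [← hPa, hPQ, hQa]
    have hb0 : (∏ i, ((b i).factorial : ℝ)) ≠ 0 := by positivity
    rw [div_mul_eq_mul_div, eq_div_iff hk2]
    refine mul_left_cancel₀ hb0 ?_
    calc _ = (∏ i, ((a i).factorial : ℝ)) * (∏ i, ((b i).factorial : ℝ)) *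
          ((Nat.multinomial Finset.univ a : ℝ) * sphereFunctional n hr (monomial a 1)) := by
            rw [← hm1']; ring
      _ = _ := by rw [key, ← hg, ← hm2']; ring
  · push Not at hev
    obtain ⟨i, hi⟩ := hev
    have hQa : coeff a Q = 0 := by
      simp only [Q, coeff_sum, coeff_monomial]
      refine Finset.sum_eq_zero fun b _ => if_neg fun h => hi ?_
      rw [← h]; simp [F]
    have h0 : (Nat.multinomial Finset.univ (a : Fin n → ℕ) : ℝ) ≠ 0 := by
      intro h0; rw [h0, mul_zero] at hm1'; exact hk2 hm1'.symm
    rw [Finset.prod_eq_zero (Finset.mem_univ i) (by simp [evenFactor, hi]), mul_zero]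
    rw [hPQ, hQa] at hPa
    exact (mul_eq_zero.1 hPa.symm).resolve_left h0

theorem isSphereFunctional_sphereFunctional (n : ℕ) [NeZero n] {r : ℝ} (hr : 0 ≤ r) (k : ℕ) :
    IsSphereFunctional r k (sphereFunctional n hr) where
  map_one := by simp [sphereFunctional, realValue]
  map_mul_normSq p := by
    simp only [sphereFunctional, LinearMap.coe_mk, AddHom.coe_mk]
    rw [← integral_const_mul]
    refine integral_congr_ae ?_
    filter_upwards [ae_sphereMeasure n hr] with x hx
    have h1 : realValue x (normSqPoly n) = r := (realValue_normSqPoly x).trans hx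
    rw [realValue, map_mul]
    change realValue x p * realValue x (normSqPoly n) = _
    rw [h1, mul_comm]
  map_odd a ha := by
    have h := integral_comp_isometry r (LinearIsometryEquiv.neg ℝ)
      (fun x : EuclideanSpace ℝ (Fin n) => realValue x (monomial a 1))
    simp only [LinearIsometryEquiv.coe_neg, realValue_neg_monomial _ a ha, integral_neg] at h
    change ∫ x, realValue x (monomial a 1) ∂(sphereMeasure n r) = 0
    linarith
  exists_map_eq := exists_sphere_moment_eq hr k

/-! ### A criterion for cubature formulas -/

/-- A weighted finite set of total weight `1` on a sphere, symmetric about the origin, is a cubature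
formula of strength `2k + 1` as soon as its moments of degree `2k` are proportional to those of
the sphere. -/
theorem isCubatureFormula_of_moments {n : ℕ} [NeZero n] {r : ℝ} (hr : 0 < r) (k : ℕ)
    (X : Finset (EuclideanSpace ℝ (Fin n))) (W : EuclideanSpace ℝ (Fin n) → ℝ)
    (hX : ∀ x ∈ X, x ∈ normSphere n r) (hW : ∀ x ∈ X, 0 < W x)
    (hneg : ∀ x ∈ X, -x ∈ X) (hWneg : ∀ x ∈ X, W (-x) = W x) (hone : ∑ x ∈ X, W x = 1)
    (hmom : ∃ c : ℝ, ∀ a : Fin n → ℕ, ∑ i, a i = 2 * k →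
      ∑ x ∈ X, W x * ∏ i, x i ^ a i = c * ∏ i, (evenFactor (a i) : ℝ)) :
    IsCubatureFormula (2 * k + 1) r (X : Set (EuclideanSpace ℝ (Fin n))) W := by
  refine ⟨X.finite_toSet, hX, hW, fun p hp => ?_⟩
  let L : MvPolynomial (Fin n) ℝ →ₗ[ℝ] ℝ :=
    { toFun := fun p => ∑ x ∈ X, W x * realValue x p
      map_add' := fun p q => by simp [realValue, mul_add, Finset.sum_add_distrib]
      map_smul' := fun c p => by simp [realValue, smul_eval, Finset.mul_sum, mul_left_comm] }
  have hLdef : ∀ p, L p = ∑ x ∈ X, W x * realValue x p := fun p => rfl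
  have hL : IsSphereFunctional r k L :=
    { map_one := by simp [hLdef, realValue, hone]
      map_mul_normSq := fun p => by
        rw [hLdef, hLdef, Finset.mul_sum]
        refine Finset.sum_congr rfl fun x hx => ?_
        have h1 : realValue x (normSqPoly n) = r := (realValue_normSqPoly x).trans (hX x hx)
        have h2 : realValue x (p * normSqPoly n) = realValue x p * realValue x (normSqPoly n) :=
          map_mul _ _ _
        rw [h2, h1]; ring
      map_odd := fun a ha => by
        have h : L (monomial a 1) = -L (monomial a 1) := by
          conv_lhs => rw [hLdef]
          rw [hLdef, ← Finset.sum_neg_distrib]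
          refine Finset.sum_nbij' (fun x => -x) (fun x => -x) hneg hneg (by simp) (by simp) ?_
          intro x hx
          rw [hWneg x hx, realValue_neg_monomial x a ha]; ring
        linarith
      exists_map_eq := by
        obtain ⟨c, hc⟩ := hmom
        refine ⟨c, fun a ha => ?_⟩
        rw [Finsupp.degree_eq_sum] at ha
        rw [← hc a ha, hLdef]
        simp_rw [realValue_monomial] }
  have hval : ∀ x : EuclideanSpace ℝ (Fin n), polyValue p x =
      ∑ a ∈ p.support, coeff a p * ((realValue x (monomial a 1) : ℝ) : ℂ) := fun x => by
    rw [polyValue, eval_eq']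
    refine Finset.sum_congr rfl fun a _ => ?_
    rw [realValue_monomial]
    push_cast
    rfl
  rw [finsum_mem_coe_finset]
  simp_rw [hval]
  rw [integral_finsetSum _ fun a _ =>
    ((integrable_sphereMeasure hr.le (continuous_realValue _)).ofReal).const_mul _]
  simp_rw [integral_const_mul, integral_complex_ofReal, Finset.mul_sum]
  rw [Finset.sum_comm]
  refine Finset.sum_congr rfl fun a ha => ?_
  have h := hL.eq_monomial hr.ne' (isSphereFunctional_sphereFunctional n hr.le k) a
    ((le_totalDegree ha).trans hp)
  have h' : ∑ x ∈ X, W x * realValue x (monomial a 1) =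
      ∫ x, realValue x (monomial a 1) ∂(sphereMeasure n r) := h
  rw [← h']
  push_cast
  rw [Finset.mul_sum]
  exact Finset.sum_congr rfl fun x _ => by ring

end

/-! ### The Reed-Muller code -/

/-- The `32` words of the first order Reed-Muller code of length `16`, as affine functions of the
binary digits of the position: the lower four digits of `t` are the coefficients of the linear part
and the fifth one is the constant term. -/
def rmWord (t : Fin 32) (i : Fin 16) : ℕ :=
  (t / 16 + t % 2 * (i % 2) + t / 2 % 2 * (i / 2 % 2) + t / 4 % 2 * (i / 4 % 2) +
    t / 8 % 2 * (i / 8 % 2)) % 2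

lemma rmWord_lt (t : Fin 32) (i : Fin 16) : rmWord t i < 2 := Nat.mod_lt _ two_pos

lemma rmWord_eq_zero_or_one (t : Fin 32) (i : Fin 16) : rmWord t i = 0 ∨ rmWord t i = 1 := by
  have := rmWord_lt t i
  omega

lemma mem_reedMuller_iff (v : Fin 16 → ZMod 2) :
    v ∈ reedMuller ↔ ∃ t, ∀ i, v i = (rmWord t i : ZMod 2) := by
  rw [reedMuller, Submodule.mem_span_insert]
  constructor
  · rintro ⟨a, z, hz, rfl⟩
    obtain ⟨c, rfl⟩ := (Submodule.mem_span_range_iff_exists_fun _).1 hz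
    have key : ∀ a c0 c1 c2 c3 : ZMod 2, ∃ t : Fin 32, ∀ i : Fin 16,
        a + (c0 * (((i : ℕ) / 2 ^ 0 : ℕ) : ZMod 2) + c1 * (((i : ℕ) / 2 ^ 1 : ℕ) : ZMod 2) +
          c2 * (((i : ℕ) / 2 ^ 2 : ℕ) : ZMod 2) + c3 * (((i : ℕ) / 2 ^ 3 : ℕ) : ZMod 2)) =
        (rmWord t i : ZMod 2) := by decide +kernel
    obtain ⟨t, ht⟩ := key a (c 0) (c 1) (c 2) (c 3)
    refine ⟨t, fun i => ?_⟩
    rw [← ht i]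
    simp [Fin.sum_univ_four]
  · rintro ⟨t, ht⟩
    have key : ∀ t : Fin 32, ∃ a : ZMod 2, ∃ c0 c1 c2 c3 : ZMod 2, ∀ i : Fin 16,
        a + (c0 * (((i : ℕ) / 2 ^ 0 : ℕ) : ZMod 2) + c1 * (((i : ℕ) / 2 ^ 1 : ℕ) : ZMod 2) +
          c2 * (((i : ℕ) / 2 ^ 2 : ℕ) : ZMod 2) + c3 * (((i : ℕ) / 2 ^ 3 : ℕ) : ZMod 2)) =
        (rmWord t i : ZMod 2) := by decide +kernel
    obtain ⟨a, c0, c1, c2, c3, h⟩ := key t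
    refine ⟨a, _, (Submodule.mem_span_range_iff_exists_fun _).2 ⟨![c0, c1, c2, c3], rfl⟩, ?_⟩
    ext i
    rw [ht i, ← h i]
    simp [Fin.sum_univ_four]

lemma rmWord_injective (t t' : Fin 32) (h : ∀ i, rmWord t i = rmWord t' i) : t = t' := by
  have h0 := h 0
  have h1 := h 1
  have h2 := h 2
  have h4 := h 4
  have h8 := h 8
  simp only [rmWord, Fin.coe_ofNat_eq_mod] at h0 h1 h2 h4 h8
  norm_num at h0 h1 h2 h4 h8
  have e0 : (t : ℕ) / 16 = t' / 16 := by omega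
  have e1 : (t : ℕ) % 2 = t' % 2 := by omega
  have e2 : (t : ℕ) / 2 % 2 = t' / 2 % 2 := by omega
  have e3 : (t : ℕ) / 4 % 2 = t' / 4 % 2 := by omega
  have e4 : (t : ℕ) / 8 % 2 = t' / 8 % 2 := by omega
  clear h h0 h1 h2 h4 h8
  omega

lemma four_dvd_sum_rmWord : ∀ t : Fin 32, 4 ∣ ∑ i, rmWord t i := by decide +kernel

lemma rmWord_zero (i : Fin 16) : rmWord 0 i = 0 := by revert i; decide

lemma rmWord_sixteen (i : Fin 16) : rmWord 16 i = 1 := by revert i; decide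

lemma digits_xor_fin32 : ∀ s t : Fin 32, ((s ^^^ t : Fin 32) : ℕ) % 2 = (s + t : ℕ) % 2 ∧
    ((s ^^^ t : Fin 32) : ℕ) / 2 % 2 = (s / 2 + t / 2 : ℕ) % 2 ∧
    ((s ^^^ t : Fin 32) : ℕ) / 4 % 2 = (s / 4 + t / 4 : ℕ) % 2 ∧
    ((s ^^^ t : Fin 32) : ℕ) / 8 % 2 = (s / 8 + t / 8 : ℕ) % 2 ∧
    ((s ^^^ t : Fin 32) : ℕ) / 16 = (s / 16 + t / 16 : ℕ) % 2 := by
  decide +kernel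

lemma digits_xor_fin16 : ∀ i j : Fin 16, ((i ^^^ j : Fin 16) : ℕ) % 2 = (i + j : ℕ) % 2 ∧
    ((i ^^^ j : Fin 16) : ℕ) / 2 % 2 = (i / 2 + j / 2 : ℕ) % 2 ∧
    ((i ^^^ j : Fin 16) : ℕ) / 4 % 2 = (i / 4 + j / 4 : ℕ) % 2 ∧
    ((i ^^^ j : Fin 16) : ℕ) / 8 % 2 = (i / 8 + j / 8 : ℕ) % 2 := by
  decide +kernel

lemma rmWord_xor (s t : Fin 32) (i : Fin 16) :
    rmWord (s ^^^ t) i = (rmWord s i + rmWord t i) % 2 := by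
  obtain ⟨h0, h1, h2, h3, h4⟩ := digits_xor_fin32 s t
  unfold rmWord
  rw [h0, h1, h2, h3, h4]
  refine (ZMod.natCast_eq_natCast_iff' _ _ 2).1 ?_
  push_cast [ZMod.natCast_mod]
  ring

lemma rmWord_add (t : Fin 32) (i j : Fin 16) :
    rmWord t (i ^^^ j) = (rmWord t i + rmWord t j + rmWord t 0) % 2 := by
  obtain ⟨h0, h1, h2, h3⟩ := digits_xor_fin16 i j
  have z : rmWord t 0 = t / 16 % 2 := by simp [rmWord]
  rw [z]
  unfold rmWord
  rw [h0, h1, h2, h3]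
  refine (ZMod.natCast_eq_natCast_iff' _ _ 2).1 ?_
  push_cast [ZMod.natCast_mod]
  have two : (2 : ZMod 2) = 0 := rfl
  linear_combination (-((t / 16 : ℕ) : ZMod 2)) * two

/-! ### Integral coordinates for the Barnes-Wall lattice and its rescaled dual -/

/-- `x / √2` is in the Barnes-Wall lattice. -/
def IsBW (x : Fin 16 → ℤ) : Prop :=
  (∃ t, ∀ i, x i % 2 = rmWord t i) ∧ 4 ∣ ∑ i, x i

/-- `x / 2` is in the rescaled dual of the Barnes-Wall lattice. -/
def IsBWDual (x : Fin 16 → ℤ) : Prop :=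
  (∃ p : Fin 2, ∀ i, x i % 2 = (p : ℕ)) ∧ ∀ t, 4 ∣ ∑ i, rmWord t i * x i

lemma mem_BW_iff (v : EuclideanSpace ℝ (Fin 16)) :
    v ∈ BW ↔ ∃ x, IsBW x ∧ ∀ i, v i = (x i : ℝ) / √2 := by
  have h : ∀ x : Fin 16 → ℤ, (fun i => (x i : ZMod 2)) ∈ reedMuller ↔
      ∃ t, ∀ i, x i % 2 = rmWord t i := fun x => by
    rw [mem_reedMuller_iff]
    refine exists_congr fun t => forall_congr' fun i => ?_
    have e : ((rmWord t i : ℕ) : ZMod 2) = ((rmWord t i : ℤ) : ZMod 2) := by push_cast; rfl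
    rw [e, ZMod.intCast_eq_intCast_iff']
    have := rmWord_lt t i
    push_cast
    omega
  constructor
  · rintro ⟨x, hx, hx4, hv⟩
    exact ⟨x, ⟨(h x).1 hx, hx4⟩, hv⟩
  · rintro ⟨x, ⟨hx, hx4⟩, hv⟩
    exact ⟨x, (h x).2 hx, hx4, hv⟩

lemma IsBW.exists_eq {x : Fin 16 → ℤ} (hx : IsBW x) :
    ∃ t, ∃ k : Fin 16 → ℤ, (∀ i, x i = rmWord t i + 2 * k i) ∧ Even (∑ i, k i) := by
  obtain ⟨⟨t, ht⟩, h4⟩ := hx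
  refine ⟨t, fun i => x i / 2, fun i => ?_, ?_⟩
  · have := ht i; dsimp only; omega
  · have h1 : ∑ i, x i = ((∑ i, rmWord t i : ℕ) : ℤ) + 2 * ∑ i, x i / 2 := by
      rw [Finset.mul_sum]; push_cast
      rw [← Finset.sum_add_distrib]
      exact Finset.sum_congr rfl fun i _ => by have := ht i; omega
    have h2 := four_dvd_sum_rmWord t
    rw [Int.even_iff]
    dsimp only
    omega

lemma isBW_of_eq (t : Fin 32) {x k : Fin 16 → ℤ} (hx : ∀ i, x i = rmWord t i + 2 * k i)
    (hk : Even (∑ i, k i)) : IsBW x := by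
  refine ⟨⟨t, fun i => ?_⟩, ?_⟩
  · have := hx i; have := rmWord_lt t i; omega
  · have h1 : ∑ i, x i = ((∑ i, rmWord t i : ℕ) : ℤ) + 2 * ∑ i, k i := by
      rw [Finset.mul_sum]; push_cast
      rw [← Finset.sum_add_distrib]
      exact Finset.sum_congr rfl fun i _ => hx i
    have h2 := four_dvd_sum_rmWord t
    rw [Int.even_iff] at hk
    omega

/-- The scalar products of the vectors of the two lattices, in integral coordinates. -/
lemma IsBWDual.four_dvd {w x : Fin 16 → ℤ} (hw : IsBWDual w) (hx : IsBW x) :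
    4 ∣ ∑ i, x i * w i := by
  obtain ⟨t, k, hk, hke⟩ := hx.exists_eq
  obtain ⟨⟨p, hp⟩, hd⟩ := hw
  have h1 : ∑ i, x i * w i = ∑ i, rmWord t i * w i + 2 * ∑ i, k i * w i := by
    rw [Finset.mul_sum, ← Finset.sum_add_distrib]
    exact Finset.sum_congr rfl fun i _ => by rw [hk i]; ring
  have h2 : ∑ i, k i * w i = (p : ℕ) * ∑ i, k i + 2 * ∑ i, k i * (w i / 2) := by
    rw [Finset.mul_sum, Finset.mul_sum, ← Finset.sum_add_distrib]
    refine Finset.sum_congr rfl fun i _ => ?_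
    have h3 : w i = (p : ℕ) + 2 * (w i / 2) := by have := hp i; omega
    conv_lhs => rw [h3]
    ring
  obtain ⟨s, hs⟩ := hke
  obtain ⟨q, hq⟩ := hd t
  rw [h1, h2, hs, hq]
  exact ⟨q + (p : ℕ) * s + ∑ i, k i * (w i / 2), by ring⟩

lemma sum_pi_single_mul (c : ℤ) (j : Fin 16) (w : Fin 16 → ℝ) :
    ∑ i, ((Pi.single j c : Fin 16 → ℤ) i : ℝ) * w i = c * w j := by
  rw [Finset.sum_eq_single j] <;> simp +contextual

lemma mem_BW'_iff (v : EuclideanSpace ℝ (Fin 16)) :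
    v ∈ BW' ↔ ∃ w, IsBWDual w ∧ ∀ i, v i = (w i : ℝ) / 2 := by
  have h2 : √2 * √2 = 2 := Real.mul_self_sqrt zero_le_two
  have h20 : √2 ≠ 0 := by positivity
  have hmem : v ∈ BW' ↔ ∀ x, IsBW x → ∃ z : ℤ, ∑ i, (x i : ℝ) * v i = 2 * z := by
    rw [BW', Set.mem_smul_set_iff_inv_smul_mem₀ h20]
    have hdual : (√2)⁻¹ • v ∈ (dualLattice barnesWall : Set (EuclideanSpace ℝ (Fin 16))) ↔
        ∀ y ∈ BW, ∃ z : ℤ, (z : ℝ) = inner ℝ ((√2)⁻¹ • v) y := by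
      simp only [dualLattice, SetLike.mem_coe, LinearMap.BilinForm.mem_dualSubmodule,
        Submodule.mem_one]
      rfl
    rw [hdual]
    have hin : ∀ (x : Fin 16 → ℤ) (y : EuclideanSpace ℝ (Fin 16)), (∀ i, y i = (x i : ℝ) / √2) →
        inner ℝ ((√2)⁻¹ • v) y = (∑ i, (x i : ℝ) * v i) / 2 := fun x y hy => by
      rw [PiLp.inner_apply, Finset.sum_div]
      refine Finset.sum_congr rfl fun i _ => ?_
      simp only [PiLp.smul_apply, hy i, smul_eq_mul, RCLike.inner_apply, conj_trivial]
      field_simp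
      rw [sq, h2]; ring
    constructor
    · intro h x hx
      obtain ⟨z, hz⟩ := h (WithLp.toLp 2 fun i => (x i : ℝ) / √2)
        ((mem_BW_iff _).2 ⟨x, hx, fun i => rfl⟩)
      exact ⟨z, by rw [hin x _ fun i => rfl] at hz; linarith⟩
    · intro h y hy
      obtain ⟨x, hx, hxy⟩ := (mem_BW_iff y).1 hy
      obtain ⟨z, hz⟩ := h x hx
      exact ⟨z, by rw [hin x y hxy, hz]; ring⟩
  rw [hmem]
  constructor
  · intro h
    -- Test vectors: `4eⱼ`, `2eᵢ + 2eⱼ` and the words of the Reed-Muller code.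
    have hA : ∀ j, ∃ z : ℤ, 2 * v j = z := fun j => by
      obtain ⟨z, hz⟩ := h (Pi.single j 4) (isBW_of_eq 0 (k := Pi.single j 2) (fun i => by
        rw [rmWord_zero]; simp only [Pi.single_apply]; split_ifs <;> simp) (by
        simp))
      rw [sum_pi_single_mul] at hz
      exact ⟨z, by push_cast at hz; linarith⟩
    choose w hw using hA
    have hv : ∀ i, v i = (w i : ℝ) / 2 := fun i => by rw [← hw i]; ring
    refine ⟨w, ⟨?_, ?_⟩, hv⟩
    · refine ⟨⟨(w 0 % 2).toNat, by omega⟩, fun i => ?_⟩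
      obtain ⟨z, hz⟩ := h (Pi.single i 2 + Pi.single 0 2)
        (isBW_of_eq 0 (k := Pi.single i 1 + Pi.single 0 1) (fun i => by
        rw [rmWord_zero]; simp only [Pi.add_apply, Pi.single_apply]; split_ifs <;> simp) (by
        simp [Finset.sum_add_distrib]))
      have hz' : ∑ j, ((Pi.single i 2 : Fin 16 → ℤ) j : ℝ) * v j +
          ∑ j, ((Pi.single 0 2 : Fin 16 → ℤ) j : ℝ) * v j = 2 * z := by
        rw [← hz, ← Finset.sum_add_distrib]
        exact Finset.sum_congr rfl fun j _ => by push_cast [Pi.add_apply]; ring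
      rw [sum_pi_single_mul, sum_pi_single_mul, hv, hv] at hz'
      push_cast at hz'
      have hz2 : w i + w 0 = 2 * z := by
        have : ((w i + w 0 : ℤ) : ℝ) = ((2 * z : ℤ) : ℝ) := by push_cast; linarith
        exact_mod_cast this
      simp only
      omega
    · intro t
      obtain ⟨z, hz⟩ := h (fun i => rmWord t i) (isBW_of_eq t (k := 0) (by simp) (by simp))
      refine ⟨z, ?_⟩
      have : ((∑ i, (rmWord t i : ℤ) * w i : ℤ) : ℝ) = ((4 * z : ℤ) : ℝ) := by
        push_cast
        simp_rw [hv] at hz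
        push_cast at hz
        have e : ∑ i, (rmWord t i : ℝ) * ((w i : ℝ) / 2) = (∑ i, (rmWord t i : ℝ) * w i) / 2 := by
          rw [Finset.sum_div]; exact Finset.sum_congr rfl fun i _ => by ring
        rw [e] at hz
        linarith
      exact_mod_cast this
  · rintro ⟨w, hw, hv⟩ x hx
    obtain ⟨z, hz⟩ := hw.four_dvd hx
    refine ⟨z, ?_⟩
    have hz' : ∑ i, (x i : ℝ) * w i = 4 * z := by exact_mod_cast hz
    simp_rw [hv]
    have e : ∑ i, (x i : ℝ) * ((w i : ℝ) / 2) = (∑ i, (x i : ℝ) * w i) / 2 := by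
      rw [Finset.sum_div]; exact Finset.sum_congr rfl fun i _ => by ring
    rw [e, hz']; ring

/-! ### Symmetries -/

/-- The map which adds `v` (bitwise) to the positions where the word `t` is `1`. -/
def shear (t : Fin 32) (v : Fin 16) (i : Fin 16) : Fin 16 :=
  if rmWord t i = 1 then i ^^^ v else i

/-- `shear t v` is an affine involution of the positions: the linear part of the word `t` vanishes
on `v`. -/
def IsShear (t : Fin 32) (v : Fin 16) : Prop := rmWord t v = rmWord t 0

instance (t : Fin 32) (v : Fin 16) : Decidable (IsShear t v) := inferInstanceAs (Decidable (_ = _))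

lemma shear_involutive {t : Fin 32} {v : Fin 16} (h : IsShear t v) :
    Function.Involutive (shear t v) := by
  have hx : ∀ i v : Fin 16, (i ^^^ v) ^^^ v = i := by decide +kernel
  intro i
  by_cases hi : rmWord t i = 1
  · have h1 : rmWord t (i ^^^ v) = 1 := by
      rw [rmWord_add, hi, h]
      omega
    rw [shear, shear, if_pos hi, if_pos h1, hx]
  · rw [shear, shear, if_neg hi, if_neg hi]

/-- Shears permute the words of the Reed-Muller code. -/
lemma exists_rmWord_shear (t : Fin 32) (v : Fin 16) (s : Fin 32) :
    ∃ s', ∀ i, rmWord s (shear t v i) = rmWord s' i := by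
  by_cases h : rmWord s v = rmWord s 0
  · refine ⟨s, fun i => ?_⟩
    unfold shear
    split_ifs
    · rw [rmWord_add, h]
      have := rmWord_lt s i
      omega
    · rfl
  · refine ⟨s ^^^ t, fun i => ?_⟩
    have h1 := rmWord_lt s i
    have h2 := rmWord_lt s v
    have h3 := rmWord_lt s 0
    have h4 := rmWord_lt t i
    unfold shear
    split_ifs with hi
    · rw [rmWord_add, rmWord_xor]
      omega
    · rw [rmWord_xor]
      omega

lemma IsBW.comp_shear {x : Fin 16 → ℤ} (hx : IsBW x) {t : Fin 32} {v : Fin 16} (h : IsShear t v) :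
    IsBW (fun i => x (shear t v i)) := by
  obtain ⟨⟨s, hs⟩, h4⟩ := hx
  obtain ⟨s', hs'⟩ := exists_rmWord_shear t v s
  refine ⟨⟨s', fun i => by rw [hs, hs']⟩, ?_⟩
  exact (Equiv.sum_comp (shear_involutive h).toPerm x).symm ▸ h4

lemma IsBWDual.comp_shear {x : Fin 16 → ℤ} (hx : IsBWDual x) {t : Fin 32} {v : Fin 16}
    (h : IsShear t v) : IsBWDual (fun i => x (shear t v i)) := by
  obtain ⟨⟨p, hp⟩, h4⟩ := hx
  refine ⟨⟨p, fun i => hp _⟩, fun s => ?_⟩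
  obtain ⟨s', hs'⟩ := exists_rmWord_shear t v s
  have h1 := h4 s'
  rw [← Equiv.sum_comp (shear_involutive h).toPerm] at h1
  convert h1 using 3 with i
  · rw [← hs']
    change _ = (rmWord s (shear t v (shear t v i)) : ℤ)
    rw [shear_involutive h]
  · rfl

lemma IsBW.neg {x : Fin 16 → ℤ} (hx : IsBW x) : IsBW (-x) := by
  obtain ⟨⟨s, hs⟩, h4⟩ := hx
  refine ⟨⟨s, fun i => ?_⟩, by simpa using h4⟩
  rw [← hs, Pi.neg_apply]; omega

lemma IsBWDual.neg {x : Fin 16 → ℤ} (hx : IsBWDual x) : IsBWDual (-x) := by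
  obtain ⟨⟨p, hp⟩, h4⟩ := hx
  refine ⟨⟨p, fun i => ?_⟩, fun t => by simpa using h4 t⟩
  rw [← hp i, Pi.neg_apply]; omega

/-! ### Moments of the integral shells -/

/-- The integral vectors of square norm `N`. -/
def intShell (N : ℕ) : Finset (Fin 16 → ℤ) :=
  (Fintype.piFinset fun _ => Finset.Icc (-(N : ℤ)) N).filter fun x => ∑ i, x i ^ 2 = (N : ℤ)

lemma mem_Icc_of_sum_sq {N R : ℕ} {x : Fin 16 → ℤ} (hx : ∑ i, x i ^ 2 = (N : ℤ))
    (hR : N < (R + 1) ^ 2)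
    (i : Fin 16) : x i ∈ Finset.Icc (-(R : ℤ)) R := by
  have h1 : x i ^ 2 ≤ N := hx ▸ Finset.single_le_sum (f := fun i => x i ^ 2)
    (fun i _ => sq_nonneg (x i)) (Finset.mem_univ i)
  have h2 : x i ^ 2 < (R + 1 : ℤ) ^ 2 := lt_of_le_of_lt h1 (by exact_mod_cast hR)
  have h3 := abs_lt_of_sq_lt_sq h2 (by positivity)
  rw [abs_lt] at h3
  rw [Finset.mem_Icc]
  constructor <;> linarith

lemma mem_intShell {N : ℕ} {x : Fin 16 → ℤ} : x ∈ intShell N ↔ ∑ i, x i ^ 2 = (N : ℤ) := by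
  rw [intShell, Finset.mem_filter, Fintype.mem_piFinset]
  refine ⟨fun h => h.2, fun h => ⟨mem_Icc_of_sum_sq h ?_, h⟩⟩
  nlinarith

lemma intShell_eq {N R : ℕ} (hR : N < (R + 1) ^ 2) :
    intShell N = (Fintype.piFinset fun _ => Finset.Icc (-(R : ℤ)) R).filter
      fun x => ∑ i, x i ^ 2 = (N : ℤ) := by
  ext x
  rw [mem_intShell, Finset.mem_filter, Fintype.mem_piFinset]
  exact ⟨fun h => ⟨mem_Icc_of_sum_sq h hR, h⟩, fun h => h.2⟩

open Classical in
/-- The sum of the monomial of exponent `e` over the integral vectors of square norm `N` with the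
property `P`. -/
def moment (P : (Fin 16 → ℤ) → Prop) (N : ℕ) (e : Fin 16 → ℕ) : ℤ :=
  ∑ x ∈ (intShell N).filter P, ∏ i, x i ^ e i

/-- The sum over the integral vectors of square norm `N` of a product of functions of the
coordinates. -/
def prodSum (N : ℕ) (f : Fin 16 → ℤ → ℤ) : ℤ := ∑ x ∈ intShell N, ∏ i, f i (x i)

/-- Reflection in the coordinate `i` preserves the shells. -/
lemma prodSum_eq_zero (N : ℕ) (f : Fin 16 → ℤ → ℤ) (i : Fin 16) (h : ∀ z, f i (-z) = -f i z) :
    prodSum N f = 0 := by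
  have key : prodSum N f = -prodSum N f := by
    conv_rhs => rw [prodSum, ← Finset.sum_neg_distrib]
    rw [prodSum]
    have hmem : ∀ x ∈ intShell N, Function.update x i (-x i) ∈ intShell N := fun x hx => by
      rw [mem_intShell] at hx ⊢
      rw [← hx]
      refine Finset.sum_congr rfl fun j _ => ?_
      rcases eq_or_ne j i with rfl | hj
      · simp
      · simp [hj]
    refine Finset.sum_nbij' (fun x => Function.update x i (-x i))
      (fun x => Function.update x i (-x i)) hmem hmem (by simp) (by simp) fun x _ => ?_
    have h1 : (∏ j ∈ Finset.univ.erase i, f j (Function.update x i (-x i) j)) =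
        ∏ j ∈ Finset.univ.erase i, f j (x j) :=
      Finset.prod_congr rfl fun j hj => by rw [Function.update_of_ne (Finset.ne_of_mem_erase hj)]
    rw [← Finset.mul_prod_erase _ _ (Finset.mem_univ i),
      ← Finset.mul_prod_erase Finset.univ (fun j => f j (Function.update x i (-x i) j))
        (Finset.mem_univ i), h1, Function.update_self, h]
    ring
  omega

/-- The sign `(-1)^⌊z/2⌋`. -/
def chi (z : ℤ) : ℤ := if z % 4 < 2 then 1 else -1

lemma prod_chi_eq_ite {s : Finset (Fin 16)} (x : Fin 16 → ℤ) :
    ∏ i ∈ s, chi (x i) = if Even (∑ i ∈ s, x i / 2) then 1 else -1 := by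
  classical
  induction s using Finset.induction_on with
  | empty => simp
  | insert j s hj ih =>
    rw [Finset.prod_insert hj, Finset.sum_insert hj, ih, chi]
    have h : x j % 4 < 2 ↔ Even (x j / 2) := by rw [Int.even_iff]; omega
    by_cases h1 : x j % 4 < 2 <;> by_cases h2 : Even (∑ i ∈ s, x i / 2) <;>
      simp [Int.even_add, ← h, h1, h2]

/-- The sign which detects, among vectors whose reduction modulo `2` has a weight divisible by `4`,
those whose sum is divisible by `4`. -/
lemma prod_chi (x : Fin 16 → ℤ) (h : 4 ∣ ∑ i, x i % 2) :
    ∏ i, chi (x i) = if 4 ∣ ∑ i, x i then 1 else -1 := by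
  have h1 : ∑ i, x i = ∑ i, x i % 2 + 2 * ∑ i, x i / 2 := by
    rw [Finset.mul_sum, ← Finset.sum_add_distrib]
    exact Finset.sum_congr rfl fun i _ => by omega
  have h2 : (4 ∣ ∑ i, x i) ↔ Even (∑ i, x i / 2) := by
    rw [Int.even_iff]; omega
  rw [prod_chi_eq_ite]
  simp only [h2]

/-- The factor attached to a coordinate `z` of residue `p` modulo `2`: the sign `chi z` to the power
`s` times `z ^ e`. -/
def localFactor (p s e : ℕ) (z : ℤ) : ℤ := if z % 2 = p then chi z ^ s * z ^ e else 0

lemma localFactor_neg {p s e : ℕ} (hp : p < 2) (h : Odd (e + p * s)) (z : ℤ) :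
    localFactor p s e (-z) = -localFactor p s e z := by
  have hz : (-z) % 2 = z % 2 := by omega
  unfold localFactor
  rw [hz]
  split_ifs with hzp
  · rw [neg_pow z]
    interval_cases p
    · have : chi (-z) = chi z := by
        unfold chi
        congr 1
        simp only [eq_iff_iff]
        push_cast at hzp
        omega
      rw [this, Odd.neg_one_pow (by simpa using h)]; ring
    · have : chi (-z) = -chi z := by
        unfold chi
        push_cast at hzp
        split_ifs <;> omega
      rw [this, neg_pow (chi z)]
      have h2 : (-1 : ℤ) ^ s * (-1) ^ e = -1 := by
        rw [← pow_add]; exact Odd.neg_one_pow (by rw [add_comm]; simpa using h)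
      linear_combination (chi z ^ s * z ^ e) * h2
  · simp

lemma prod_localFactor (p s e : Fin 16 → ℕ) (x : Fin 16 → ℤ) :
    ∏ i, localFactor (p i) (s i) (e i) (x i) =
      if ∀ i, x i % 2 = p i then (∏ i, chi (x i) ^ s i) * ∏ i, x i ^ e i else 0 := by
  unfold localFactor
  rw [Finset.prod_ite_zero, Finset.prod_mul_distrib]
  simp

open Classical in
/-- Detection of the Barnes-Wall lattice by characters. -/
lemma sum_localFactor_rmWord (x : Fin 16 → ℤ) (e : Fin 16 → ℕ) :
    ∑ u : Fin 32 × Fin 2, ∏ i, localFactor (rmWord u.1 i) u.2 (e i) (x i) =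
      if IsBW x then 2 * ∏ i, x i ^ e i else 0 := by
  simp_rw [prod_localFactor, Fintype.sum_prod_type, Fin.sum_univ_two]
  by_cases h : ∃ t, ∀ i, x i % 2 = rmWord t i
  · obtain ⟨t, ht⟩ := h
    rw [Finset.sum_eq_single_of_mem t (Finset.mem_univ t), if_pos ht, if_pos ht]
    · have h4 : (4 : ℤ) ∣ ∑ i, x i % 2 := by
        simp_rw [ht]; exact_mod_cast four_dvd_sum_rmWord t
      have hBW : IsBW x ↔ 4 ∣ ∑ i, x i := ⟨fun h => h.2, fun h => ⟨⟨t, ht⟩, h⟩⟩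
      simp only [hBW, Fin.val_zero, Fin.val_one, pow_zero, pow_one, prod_chi x h4]
      split_ifs <;> simp
      ring
    · intro t' _ htt'
      have : ¬ ∀ i, x i % 2 = rmWord t' i := fun h' => htt' (rmWord_injective _ _ fun i => by
        have := h' i; have := ht i; omega)
      rw [if_neg this, if_neg this, add_zero]
  · have h0 : ∀ t, ¬ ∀ i, x i % 2 = rmWord t i := fun t ht => h ⟨t, ht⟩
    have hBW : ¬ IsBW x := fun hx => h hx.1
    simp [h0, hBW]

open Classical in
/-- Detection of the rescaled dual lattice by characters. -/
lemma sum_localFactor_dual (x : Fin 16 → ℤ) (e : Fin 16 → ℕ) :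
    ∑ u : Fin 32 × Fin 2, ∏ i, localFactor u.2 (rmWord u.1 i) (e i) (x i) =
      if IsBWDual x then 32 * ∏ i, x i ^ e i else 0 := by
  simp_rw [prod_localFactor, Fintype.sum_prod_type_right]
  by_cases h : ∃ p : Fin 2, ∀ i, x i % 2 = (p : ℕ)
  · obtain ⟨p, hp⟩ := h
    rw [Finset.sum_eq_single_of_mem p (Finset.mem_univ p)]
    · simp_rw [if_pos hp, ← Finset.sum_mul]
      set F : Fin 32 → ℤ := fun t => ∏ i, chi (x i) ^ rmWord t i with hF
      have hFt : ∀ t, F t = if 4 ∣ ∑ i, rmWord t i * x i then 1 else -1 := fun t => by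
        rw [← prod_chi]
        · refine Finset.prod_congr rfl fun i _ => ?_
          rcases rmWord_eq_zero_or_one t i with h | h <;> simp [h, chi]
        · have : ∀ i, (rmWord t i * x i : ℤ) % 2 = rmWord t i * (p : ℕ) := fun i => by
            have := hp i
            rcases rmWord_eq_zero_or_one t i with h | h <;> simp [h, this]
          simp_rw [this, ← Finset.sum_mul]
          exact Dvd.dvd.mul_right (by exact_mod_cast four_dvd_sum_rmWord t) _
      have hBW : IsBWDual x ↔ ∀ t, 4 ∣ ∑ i, rmWord t i * x i :=
        ⟨fun h => h.2, fun h => ⟨⟨p, hp⟩, h⟩⟩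
      by_cases hall : ∀ t, 4 ∣ ∑ i, rmWord t i * x i
      · rw [if_pos (hBW.2 hall)]
        simp_rw [hFt, if_pos (hall _)]
        simp
      · rw [if_neg fun h => hall (hBW.1 h)]
        push Not at hall
        obtain ⟨s, hs⟩ := hall
        -- Translation by a word on which the character is `-1` changes the sign of the sum.
        have hadd : ∀ t, F (t ^^^ s) = -F t := fun t => by
          have h1 : F s = -1 := by rw [hFt, if_neg hs]
          have h2 : F (t ^^^ s) = F t * F s := by
            rw [hF]
            simp only
            rw [← Finset.prod_mul_distrib]
            refine Finset.prod_congr rfl fun i _ => ?_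
            have hc : chi (x i) = 1 ∨ chi (x i) = -1 := by unfold chi; split_ifs <;> simp
            rw [rmWord_xor]
            rcases rmWord_eq_zero_or_one t i with h | h <;>
            rcases rmWord_eq_zero_or_one s i with h' | h' <;>
            rcases hc with hc | hc <;> simp [h, h', hc]
          rw [h2, h1]; ring
        have hinv : Function.Involutive fun t : Fin 32 => t ^^^ s := by
          have : ∀ t s : Fin 32, (t ^^^ s) ^^^ s = t := by decide +kernel
          exact fun t => this t s
        have hsum : ∑ t, F t = -∑ t, F t := by
          conv_lhs => rw [← Equiv.sum_comp hinv.toPerm F]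
          rw [← Finset.sum_neg_distrib]
          exact Finset.sum_congr rfl fun t _ => hadd t
        have h0 : ∑ t, F t = 0 := by omega
        rw [h0, zero_mul]
    · intro p' _ hpp'
      have : ¬ ∀ i, x i % 2 = ((p' : ℕ) : ℤ) := fun h' => hpp' (by
        have := h' 0; have := hp 0; ext; omega)
      simp [this]
  · have h0 : ∀ p : Fin 2, ¬ ∀ i, x i % 2 = ((p : ℕ) : ℤ) := fun t ht => h ⟨t, ht⟩
    have hBW : ¬ IsBWDual x := fun hx => h hx.1
    simp [h0, hBW]

lemma two_mul_moment (N : ℕ) (e : Fin 16 → ℕ) :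
    2 * moment IsBW N e =
      ∑ u : Fin 32 × Fin 2, prodSum N fun i => localFactor (rmWord u.1 i) u.2 (e i) := by
  classical
  unfold prodSum moment
  rw [Finset.sum_comm, Finset.mul_sum, Finset.sum_filter]
  exact Finset.sum_congr rfl fun x _ => by rw [sum_localFactor_rmWord]

lemma thirtytwo_mul_moment (N : ℕ) (e : Fin 16 → ℕ) :
    32 * moment IsBWDual N e =
      ∑ u : Fin 32 × Fin 2, prodSum N fun i => localFactor u.2 (rmWord u.1 i) (e i) := by
  classical
  unfold prodSum moment
  rw [Finset.sum_comm, Finset.mul_sum, Finset.sum_filter]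
  exact Finset.sum_congr rfl fun x _ => by rw [sum_localFactor_dual]

/-- If the parities of an exponent do not form a word of the code, then every product of local
factors which detects one of the two lattices has an odd factor, so that its sum over a shell
vanishes. -/
lemma exists_odd_of_not_rmWord {e : Fin 16 → ℕ} (he : ¬ ∃ t, ∀ i, e i % 2 = rmWord t i)
    (t : Fin 32) (s : Fin 2) : ∃ i, Odd (e i + rmWord t i * s) := by
  by_contra! h
  simp only [Nat.not_odd_iff_even, Nat.even_iff] at h
  obtain rfl | rfl : s = 0 ∨ s = 1 := by omega
  · exact he ⟨0, fun i => by rw [rmWord_zero]; simpa using h i⟩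
  · refine he ⟨t, fun i => ?_⟩
    have h1 := h i
    have h2 := rmWord_lt t i
    simp only [Fin.val_one, mul_one] at h1
    omega

lemma moment_eq_zero {e : Fin 16 → ℕ} (he : ¬ ∃ t, ∀ i, e i % 2 = rmWord t i) (N : ℕ) :
    moment IsBW N e = 0 := by
  have h := two_mul_moment N e
  rw [Finset.sum_eq_zero] at h
  · omega
  · rintro ⟨t, s⟩ _
    obtain ⟨i, hi⟩ := exists_odd_of_not_rmWord he t s
    exact prodSum_eq_zero _ _ i (localFactor_neg (rmWord_lt t i) hi)

lemma moment_dual_eq_zero {e : Fin 16 → ℕ} (he : ¬ ∃ t, ∀ i, e i % 2 = rmWord t i) (N : ℕ) :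
    moment IsBWDual N e = 0 := by
  have h := thirtytwo_mul_moment N e
  rw [Finset.sum_eq_zero] at h
  · omega
  · rintro ⟨t, s⟩ _
    obtain ⟨i, hi⟩ := exists_odd_of_not_rmWord he t s
    exact prodSum_eq_zero _ _ i (localFactor_neg s.2 (by rwa [mul_comm]))

lemma moment_comp_shear {P : (Fin 16 → ℤ) → Prop} {t : Fin 32} {v : Fin 16} (h : IsShear t v)
    (hP : ∀ x, P x → P fun i => x (shear t v i)) (N : ℕ) (e : Fin 16 → ℕ) :
    moment P N (fun i => e (shear t v i)) = moment P N e := by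
  classical
  let σ := (shear_involutive h).toPerm
  have hmem : ∀ x ∈ (intShell N).filter P, x ∘ σ ∈ (intShell N).filter P := fun x hx => by
    rw [Finset.mem_filter, mem_intShell] at hx ⊢
    refine ⟨?_, hP x hx.2⟩
    rw [← hx.1]; exact Equiv.sum_comp σ fun i => x i ^ 2
  have hinv : ∀ x : Fin 16 → ℤ, (x ∘ σ) ∘ σ = x := fun x => by
    ext i
    exact congrArg x (shear_involutive h i)
  refine Finset.sum_nbij' (fun x => x ∘ σ) (fun x => x ∘ σ) hmem hmem (fun x _ => hinv x)
    (fun x _ => hinv x) fun x _ => ?_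
  rw [← Equiv.prod_comp σ]
  refine Finset.prod_congr rfl fun i _ => ?_
  change x (σ i) ^ e (shear t v (shear t v i)) = _
  rw [shear_involutive h]; rfl

/-! ### Reduction to a few exponents -/

/-- The exponent `2 ∑ e_i`, where `i` runs over the list `l` of positions. -/
def listExponent (l : List (Fin 16)) (i : Fin 16) : ℕ := 2 * l.count i

/-- The lists of `n` positions which extend a list in the span of the first `k` digits, such that
every position is in the span of the digits which occur before it, or is the next power of `2`. -/
def growthLists : ℕ → ℕ → List (Fin 16) → List (List (Fin 16))
  | 0, _, l => [l]
  | n + 1, k, l =>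
    ((List.finRange 16).filter fun i : Fin 16 => (i : ℕ) < 2 ^ k ∨ (i : ℕ) = 2 ^ k).flatMap
      fun i : Fin 16 =>
      growthLists n (if (i : ℕ) = 2 ^ k then k + 1 else k) (l ++ [i])

lemma exists_shear_to_pow : ∀ k < 4, ∀ i : Fin 16, 2 ^ k ≤ (i : ℕ) → ∃ t v, IsShear t v ∧
    (shear t v i : ℕ) = 2 ^ k ∧ ∀ j : Fin 16, (j : ℕ) < 2 ^ k → shear t v j = j := by
  have key : ∀ k : Fin 4, ∀ i : Fin 16, 2 ^ (k : ℕ) ≤ (i : ℕ) → ∃ t,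
      IsShear t (i ^^^ ⟨2 ^ (k : ℕ) % 16, Nat.mod_lt _ (by norm_num)⟩) ∧
      (shear t (i ^^^ ⟨2 ^ (k : ℕ) % 16, Nat.mod_lt _ (by norm_num)⟩) i : ℕ) = 2 ^ (k : ℕ) ∧
      ∀ j : Fin 16, (j : ℕ) < 2 ^ (k : ℕ) →
        shear t (i ^^^ ⟨2 ^ (k : ℕ) % 16, Nat.mod_lt _ (by norm_num)⟩) j = j := by
    decide +kernel
  intro k hk i hi
  obtain ⟨t, ht⟩ := key ⟨k, hk⟩ i hi
  exact ⟨t, _, ht⟩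

lemma exists_shear_to_zero (i : Fin 16) : IsShear 16 i ∧ shear 16 i i = 0 := by
  have : ∀ i : Fin 16, i ^^^ i = 0 := by decide
  simp [IsShear, shear, rmWord_sixteen, this]

/-- A translation which preserves the hyperplane `i ≥ 8` moves every position to `0` or `8`. -/
lemma exists_translation : ∀ i : Fin 16, ∃ v, IsShear 16 v ∧
    (shear 16 v i = 0 ∨ shear 16 v i = 8) ∧ ∀ j, rmWord 8 (shear 16 v j) = rmWord 8 j := by
  decide +kernel

lemma exists_shear_to_eight : ∀ t : Fin 32, t ≠ 0 → t ≠ 16 → ∃ v,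
    IsShear (t ^^^ 8) v ∧ ∀ i, rmWord t (shear (t ^^^ 8) v i) = rmWord 8 i := by
  decide +kernel

/-- A property of lists of positions which is invariant under the affine group has to be checked for
the growth lists only. -/
lemma forall_of_growthLists {P : List (Fin 16) → Prop}
    (hP : ∀ t v, IsShear t v → ∀ l, P (l.map (shear t v)) → P l) :
    ∀ n k (l : List (Fin 16)), (∀ i ∈ l, (i : ℕ) < 2 ^ k) → (∀ l' ∈ growthLists n k l, P l') →
      ∀ m : List (Fin 16), m.length = n → P (l ++ m) := by
  intro n
  induction n with
  | zero =>
    intro k l _ h m hm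
    rw [List.length_eq_zero_iff.1 hm, List.append_nil]
    exact h l (by simp [growthLists])
  | succ n ih =>
    intro k l hl h m hm
    obtain ⟨i, m, rfl⟩ := List.exists_cons_of_length_eq_add_one hm
    simp only [List.length_cons, Nat.add_right_cancel_iff] at hm
    have step : ∀ i : Fin 16, ((i : ℕ) < 2 ^ k ∨ (i : ℕ) = 2 ^ k) → ∀ m : List (Fin 16),
        m.length = n → P (l ++ i :: m) := by
      intro i hi m hm
      have := ih (if (i : ℕ) = 2 ^ k then k + 1 else k) (l ++ [i]) (by
        intro j hj
        have h2 : 2 ^ k < 2 ^ (k + 1) := Nat.pow_lt_pow_right one_lt_two (Nat.lt_succ_self k)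
        rw [List.mem_append, List.mem_singleton] at hj
        rcases hj with hj | rfl
        · have := hl j hj
          split_ifs <;> omega
        · split_ifs <;> omega) (by
        intro l' hl'
        refine h l' ?_
        rw [growthLists, List.mem_flatMap]
        exact ⟨i, by simpa using hi, hl'⟩) m hm
      simpa using this
    by_cases hik : (i : ℕ) < 2 ^ k
    · exact step i (Or.inl hik) m hm
    · have hk : k < 4 := by
        by_contra hk
        have : 2 ^ 4 ≤ 2 ^ k := Nat.pow_le_pow_right two_pos (not_lt.1 hk)
        omega
      obtain ⟨t, v, hs, hi, hfix⟩ := exists_shear_to_pow k hk i (not_lt.1 hik)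
      refine hP t v hs _ ?_
      rw [List.map_append, List.map_cons, List.map_congr_left (g := id)
        (fun j hj => hfix j (hl j hj)), List.map_id]
      exact step _ (Or.inr hi) _ (by simpa using hm)

lemma listExponent_map_shear {t : Fin 32} {v : Fin 16} (h : IsShear t v) (l : List (Fin 16))
    (i : Fin 16) : listExponent (l.map (shear t v)) (shear t v i) = listExponent l i := by
  rw [listExponent, listExponent, List.count_map_of_injective _ _ (shear_involutive h).injective]

lemma exists_list_of_even {e : Fin 16 → ℕ} (h : ∀ i, Even (e i)) :
    ∃ l : List (Fin 16), (∀ i, e i = listExponent l i) ∧ 2 * l.length = ∑ i, e i := by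
  let b : Fin 16 → ℕ := fun i => e i / 2
  have hb : ∀ i, e i = 2 * b i := fun i => (Nat.mul_div_cancel' (h i).two_dvd).symm
  let m : Multiset (Fin 16) := ∑ i, Multiset.replicate (b i) i
  have hc : ∀ i, m.count i = b i := fun i => by
    simp only [m, Multiset.count_sum', Multiset.count_replicate]
    simp
  refine ⟨m.toList, fun i => ?_, ?_⟩
  · rw [listExponent, ← Multiset.coe_count, Multiset.coe_toList, hc, hb]
  · rw [Multiset.length_toList]
    simp only [m, Multiset.card_sum, Multiset.card_replicate, hb, Finset.mul_sum]

/-- A property of exponents of total degree `2k < 16`, which is invariant under the affine group and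
holds for all exponents whose reduction modulo `2` is not in the Reed-Muller code, has to be
checked for few exponents only: the even ones given by growth lists, and those
which are odd on the hyperplane `i ≥ 8` and exceed the minimal such exponent at `0` or `8`. -/
theorem forall_exponents {P : (Fin 16 → ℕ) → Prop} {k : ℕ} (hk : k + 1 < 8)
    (hP : ∀ t v, IsShear t v → ∀ e, P (fun i => e (shear t v i)) → P e)
    (hvan : ∀ e, (¬ ∃ t, ∀ i, e i % 2 = rmWord t i) → P e)
    (heven : ∀ l ∈ growthLists k 0 [0], P (listExponent l))
    (hodd : ∀ l : List (Fin 16), l.length + 4 = k + 1 → (∀ i ∈ l.head?, i = 0 ∨ i = 8) →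
      P fun i => rmWord 8 i + listExponent l i)
    (e : Fin 16 → ℕ) (he : ∑ i, e i = 2 * (k + 1)) : P e := by
  by_cases h : ∃ t, ∀ i, e i % 2 = rmWord t i
  swap
  · exact hvan e h
  obtain ⟨t, ht⟩ := h
  rcases eq_or_ne t 0 with rfl | h0
  · obtain ⟨l, hl, hlen⟩ := exists_list_of_even (e := e) fun i => by
      rw [Nat.even_iff, ht, rmWord_zero]
    obtain rfl : e = listExponent l := funext hl
    have hinv : ∀ t v, IsShear t v → ∀ l : List (Fin 16),
        P (listExponent (l.map (shear t v))) → P (listExponent l) := fun t v hs l hPl => by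
      refine hP t v hs _ ?_
      convert hPl using 1
      ext i
      rw [← listExponent_map_shear hs, shear_involutive hs]
    obtain ⟨i, m, rfl⟩ := List.exists_cons_of_length_eq_add_one (l := l) (n := k) (by omega)
    obtain ⟨hs, hi⟩ := exists_shear_to_zero i
    refine hinv 16 i hs _ ?_
    rw [List.map_cons, hi]
    refine forall_of_growthLists (P := fun l => P (listExponent l)) hinv k 0 [0] (by simp)
      heven _ ?_
    simp only [List.length_cons] at hlen
    rw [List.length_map]; omega
  rcases eq_or_ne t 16 with rfl | h16
  · exfalso
    have : ∑ i : Fin 16, 1 ≤ ∑ i, e i := Finset.sum_le_sum fun i _ => by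
      have := ht i; rw [rmWord_sixteen] at this; omega
    simp only [Finset.sum_const, Finset.card_univ, Fintype.card_fin, smul_eq_mul] at this
    omega
  · obtain ⟨v, hs, hv⟩ := exists_shear_to_eight t h0 h16
    refine hP _ v hs _ ?_
    set e' : Fin 16 → ℕ := fun i => e (shear (t ^^^ 8) v i) with he'
    have hmod : ∀ i, e' i % 2 = rmWord 8 i := fun i => by rw [he', ← hv i, ← ht]
    have hsum : ∑ i, e' i = 2 * (k + 1) := by
      rw [← he]; exact Equiv.sum_comp (shear_involutive hs).toPerm e
    obtain ⟨l, hl, hlen⟩ := exists_list_of_even (e := fun i => e' i - rmWord 8 i) fun i => by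
      rw [Nat.even_iff]; have := hmod i; omega
    have h1 : ∀ i, e' i = rmWord 8 i + listExponent l i := fun i => by
      have h2 := hl i; have h3 := hmod i
      have h4 := rmWord_lt 8 i
      omega
    have h8 : ∑ i, rmWord 8 i = 8 := by decide
    rw [funext h1]
    have hodd' : l.length + 4 = k + 1 → P fun i => rmWord 8 i + listExponent l i := fun hlen => by
      rcases l with _ | ⟨i, m⟩
      · exact hodd [] hlen (by simp)
      obtain ⟨v, hs, hi, hv⟩ := exists_translation i
      refine hP 16 v hs _ ?_
      convert hodd ((i :: m).map (shear 16 v)) (by simpa using hlen) (by simpa using hi) using 2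
        with j
      rw [hv, ← listExponent_map_shear hs, shear_involutive hs]
    refine hodd' ?_
    have h3 : ∑ i, e' i = ∑ i, rmWord 8 i + ∑ i, (e' i - rmWord 8 i) := by
      rw [← Finset.sum_add_distrib]
      exact Finset.sum_congr rfl fun i _ => by have := hmod i; omega
    omega

/-! ### Evaluation of the moments by Kronecker substitution -/

/-- The base in which the coefficients of the generating functions are read off as digits. It
exceeds `2 * 64 * 13 ^ 16 * 6 ^ 12`, a bound for twice the sum of the absolute values of the terms
in `sum_prodSum_eq_kronDigit`. -/
@[irreducible] def kronBase : ℕ := 2 ^ 100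

lemma kronBase_eq : kronBase = 2 ^ 100 := by rw [kronBase]

/-- The generating functions are evaluated at `kronBase` modulo this number: coefficients up to
degree `40` are kept. -/
@[irreducible] def kronModulus : ℕ := kronBase ^ 41

lemma kronModulus_eq : kronModulus = kronBase ^ 41 := by rw [kronModulus]

lemma kronModulus_pos : 0 < kronModulus := by
  rw [kronModulus_eq, kronBase_eq]; positivity

/-- The digit of index `N` of `q` in base `kronBase`, in balanced representation, as the
coefficients may be negative: the quotient is rounded to the nearest integer. -/
def kronDigit (N q : ℕ) : ℤ :=
  Int.bmod ((2 * q + kronBase ^ N) / (2 * kronBase ^ N) : ℕ) kronBase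

lemma abs_sum_filter_lt {α : Type*} (F : Finset α) (v : α → ℤ) (d : α → ℕ) (N : ℕ)
    (hv : 2 * ∑ x ∈ F, |v x| < kronBase) :
    2 * |∑ x ∈ F.filter (fun x => d x < N), v x * (kronBase : ℤ) ^ d x| < kronBase ^ N := by
  have hB : (0 : ℤ) < kronBase := by norm_num [kronBase_eq]
  rcases N with _ | N
  · simp
  have h1 : |∑ x ∈ F.filter (fun x => d x < N + 1), v x * (kronBase : ℤ) ^ d x| ≤
      ∑ x ∈ F, |v x| * (kronBase : ℤ) ^ N := by
    refine (Finset.abs_sum_le_sum_abs _ _).trans ?_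
    refine (Finset.sum_le_sum (g := fun x => |v x| * (kronBase : ℤ) ^ N) fun x hx => ?_).trans
      (Finset.sum_le_sum_of_subset_of_nonneg (Finset.filter_subset _ _) fun x _ _ => by positivity)
    rw [abs_mul, abs_of_pos (pow_pos hB _)]
    have hd : d x ≤ N := Nat.lt_succ_iff.1 (Finset.mem_filter.1 hx).2
    exact mul_le_mul_of_nonneg_left (pow_le_pow_right₀ (by omega) hd) (abs_nonneg _)
  rw [← Finset.sum_mul] at h1
  calc _ ≤ 2 * ((∑ x ∈ F, |v x|) * (kronBase : ℤ) ^ N) := by linarith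
    _ = (2 * ∑ x ∈ F, |v x|) * (kronBase : ℤ) ^ N := by ring
    _ < kronBase * (kronBase : ℤ) ^ N := mul_lt_mul_of_pos_right hv (pow_pos hB _)
    _ = _ := by ring

/-- A coefficient of a generating function whose coefficients are small is a digit of its value at
`kronBase`. -/
lemma sum_filter_eq_kronDigit {α : Type*} (F : Finset α) (v : α → ℤ) (d : α → ℕ)
    (hv : 2 * ∑ x ∈ F, |v x| < kronBase) {N : ℕ} (hN : N ≤ 40) {q : ℕ}
    (hq : (q : ℤ) ≡ ∑ x ∈ F, v x * (kronBase : ℤ) ^ d x [ZMOD kronModulus]) :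
    ∑ x ∈ F.filter (fun x => d x = N), v x = kronDigit N q := by
  have hB : (0 : ℤ) < kronBase := by norm_num [kronBase_eq]
  set m := ∑ x ∈ F.filter (fun x => d x = N), v x with hm
  set A := ∑ x ∈ F.filter (fun x => d x < N), v x * (kronBase : ℤ) ^ d x with hA
  have hAlt : 2 * |A| < (kronBase : ℤ) ^ N := abs_sum_filter_lt F v d N hv
  have hmlt : 2 * |m| < kronBase := by
    refine lt_of_le_of_lt ?_ hv
    have h1 : |m| ≤ ∑ x ∈ F, |v x| := (Finset.abs_sum_le_sum_abs _ _).trans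
      (Finset.sum_le_sum_of_subset_of_nonneg (Finset.filter_subset _ _) fun x _ _ => abs_nonneg _)
    linarith
  obtain ⟨R, hR⟩ : ∃ R, ∑ x ∈ F, v x * (kronBase : ℤ) ^ d x =
      A + m * (kronBase : ℤ) ^ N + R * (kronBase : ℤ) ^ (N + 1) := by
    refine ⟨∑ x ∈ F.filter (fun x => N < d x), v x * (kronBase : ℤ) ^ (d x - (N + 1)), ?_⟩
    rw [hA, hm, Finset.sum_mul, Finset.sum_mul, Finset.sum_filter, Finset.sum_filter,
      Finset.sum_filter, ← Finset.sum_add_distrib, ← Finset.sum_add_distrib]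
    refine Finset.sum_congr rfl fun x _ => ?_
    rcases lt_trichotomy (d x) N with h | h | h
    · rw [if_pos h, if_neg (by omega), if_neg (by omega)]; ring
    · rw [if_neg (by omega), if_pos h, if_neg (by omega), h]; ring
    · rw [if_neg (by omega), if_neg (by omega), if_pos h, mul_assoc, ← pow_add,
        Nat.sub_add_cancel h]; ring
  obtain ⟨S, hS⟩ : ∃ S, (q : ℤ) = A + m * (kronBase : ℤ) ^ N + S * (kronBase : ℤ) ^ (N + 1) := by
    obtain ⟨c, hc⟩ := hq.dvd
    have hM : (kronModulus : ℤ) = (kronBase : ℤ) ^ (N + 1) * (kronBase : ℤ) ^ (40 - N) := by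
      rw [← pow_add, show N + 1 + (40 - N) = 41 by omega]
      rw [kronModulus_eq, Nat.cast_pow]
    exact ⟨R - c * (kronBase : ℤ) ^ (40 - N), by rw [hM] at hc; linear_combination hR - hc⟩
  have hdiv : (((2 * q + kronBase ^ N) / (2 * kronBase ^ N) : ℕ) : ℤ) = m + S * kronBase := by
    push_cast
    have hpos : (0 : ℤ) < 2 * (kronBase : ℤ) ^ N := by positivity
    have h1 : 2 * (q : ℤ) + (kronBase : ℤ) ^ N =
        (2 * A + (kronBase : ℤ) ^ N) + (m + S * kronBase) * (2 * (kronBase : ℤ) ^ N) := by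
      rw [hS]; ring
    rw [h1, Int.add_mul_ediv_right _ _ hpos.ne', Int.ediv_eq_zero_of_lt, zero_add]
    · have := neg_abs_le A; linarith
    · have := le_abs_self A; linarith
  rw [kronDigit, hdiv, Int.add_mul_bmod_self_right]
  symm
  rw [Int.bmod_eq_iff (by norm_num [kronBase_eq])]
  have h2 := neg_abs_le m
  have h3 := le_abs_self m
  refine ⟨?_, ?_, ?_⟩
  · omega
  · omega
  · simp

/-- The one-variable generating function `∑ localFactor p s e z * T ^ (z ^ 2)`, `-6 ≤ z ≤ 6`, at
`T = kronBase` and modulo `kronModulus`. -/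
def localGen (p s e : ℕ) : ℕ :=
  let sgn := if s = 0 then 1 else kronModulus - 1
  if p = 0 then
    if e % 2 = 0 then ((if e = 0 then 1 else 0) +
      2 * (sgn * 2 ^ e * kronBase ^ 4 + 4 ^ e * kronBase ^ 16 + sgn * 6 ^ e * kronBase ^ 36))
        % kronModulus
    else 0
  else
    if (e + s) % 2 = 0 then
      (2 * (kronBase + sgn * 3 ^ e * kronBase ^ 9 + 5 ^ e * kronBase ^ 25)) % kronModulus
    else 0

lemma sum_Icc_six (f : ℤ → ℤ) : ∑ z ∈ Finset.Icc (-6 : ℤ) 6, f z =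
    f (-6) + f (-5) + f (-4) + f (-3) + f (-2) + f (-1) + f 0 + f 1 + f 2 + f 3 + f 4 + f 5 +
      f 6 := by
  have : Finset.Icc (-6 : ℤ) 6 = {-6, -5, -4, -3, -2, -1, 0, 1, 2, 3, 4, 5, 6} := by decide
  rw [this]
  simp [add_assoc]

lemma localGen_modEq {p s : ℕ} (hp : p < 2) (hs : s < 2) (e : ℕ) :
    (localGen p s e : ℤ) ≡ ∑ z ∈ Finset.Icc (-6 : ℤ) 6,
      localFactor p s e z * (kronBase : ℤ) ^ (z ^ 2).toNat [ZMOD kronModulus] := by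
  have hsgn : (((if s = 0 then 1 else kronModulus - 1 : ℕ) : ℕ) : ℤ) ≡ (-1) ^ s
      [ZMOD kronModulus] := by
    interval_cases s
    · simp
    · have : ((kronModulus - 1 : ℕ) : ℤ) = kronModulus - 1 :=
        Nat.cast_pred kronModulus_pos
      rw [if_neg one_ne_zero, this, Int.modEq_iff_dvd]
      exact ⟨-1, by ring⟩
  rw [sum_Icc_six]
  unfold localGen
  simp only
  set sgn : ℕ := if s = 0 then 1 else kronModulus - 1 with hsgn_def
  rcases Nat.even_or_odd e with he | he <;> interval_cases p
  · rw [if_pos rfl, if_pos (Nat.even_iff.1 he)]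
    push_cast
    refine (Int.mod_modEq _ _).trans ?_
    trans ((if e = 0 then 1 else 0) + 2 * ((-1) ^ s * 2 ^ e * (kronBase : ℤ) ^ 4 +
      4 ^ e * (kronBase : ℤ) ^ 16 + (-1) ^ s * 6 ^ e * (kronBase : ℤ) ^ 36))
    · gcongr
    · refine congrArg (· % (kronModulus : ℤ)) ?_
      interval_cases s <;> simp [localFactor, chi, he.neg_pow, zero_pow_eq] <;> ring
  · rw [if_neg one_ne_zero]
    interval_cases s
    · rw [if_pos (by simpa using Nat.even_iff.1 he)]
      push_cast
      refine (Int.mod_modEq _ _).trans ?_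
      refine congrArg (· % (kronModulus : ℤ)) ?_
      have : sgn = 1 := by rw [hsgn_def, if_pos rfl]
      simp [this, localFactor, chi, he.neg_pow]
      ring
    · have : (e + 1) % 2 = 1 := by have := Nat.even_iff.1 he; omega
      rw [if_neg (by omega)]
      refine congrArg (· % (kronModulus : ℤ)) ?_
      simp [localFactor, chi, he.neg_pow]
  · have := Nat.odd_iff.1 he
    rw [if_pos rfl, if_neg (by omega)]
    refine congrArg (· % (kronModulus : ℤ)) ?_
    interval_cases s <;> simp [localFactor, chi, he.neg_pow, zero_pow_eq] <;> omega
  · have := Nat.odd_iff.1 he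
    rw [if_neg one_ne_zero]
    interval_cases s
    · rw [if_neg (by omega)]
      refine congrArg (· % (kronModulus : ℤ)) ?_
      simp [localFactor, chi, he.neg_pow]
    · rw [if_pos (by omega)]
      push_cast
      refine (Int.mod_modEq _ _).trans ?_
      trans 2 * ((kronBase : ℤ) + (-1) ^ 1 * 3 ^ e * (kronBase : ℤ) ^ 9 +
        5 ^ e * (kronBase : ℤ) ^ 25)
      · gcongr
      · refine congrArg (· % (kronModulus : ℤ)) ?_
        simp [localFactor, chi, he.neg_pow]
        ring

/-- `localGen`, with the most frequent arguments made explicit, so that these values are computed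
only once. -/
def fastLocalGen : ℕ → ℕ → ℕ → ℕ
  | 0, 0, 0 => localGen 0 0 0
  | 0, 0, 2 => localGen 0 0 2
  | 0, 1, 0 => localGen 0 1 0
  | 0, 1, 2 => localGen 0 1 2
  | 1, 0, 0 => localGen 1 0 0
  | 1, 0, 2 => localGen 1 0 2
  | 1, 1, 1 => localGen 1 1 1
  | p, s, e => localGen p s e

lemma fastLocalGen_eq (p s e : ℕ) : fastLocalGen p s e = localGen p s e := by
  unfold fastLocalGen
  split <;> rfl

/-- The product `f 0 * ⋯ * f (n - 1)` modulo `kronModulus`. -/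
def prodMod (f : ℕ → ℕ) (n : ℕ) : ℕ :=
  n.rec 1 fun i r => match f i with
    | 0 => 0
    | a + 1 => ((a + 1) * r) % kronModulus

lemma prodMod_succ (f : ℕ → ℕ) (n : ℕ) :
    prodMod f (n + 1) = (f n * prodMod f n) % kronModulus := by
  change (match f n with
    | 0 => 0
    | a + 1 => ((a + 1) * prodMod f n) % kronModulus) = _
  split
  · next h => rw [h, zero_mul, Nat.zero_mod]
  · next a h => rw [h]

lemma prodMod_modEq (f : ℕ → ℕ) (n : ℕ) (g : Fin n → ℤ)
    (h : ∀ i : Fin n, (f i : ℤ) ≡ g i [ZMOD kronModulus]) :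
    (prodMod f n : ℤ) ≡ ∏ i, g i [ZMOD kronModulus] := by
  induction n with
  | zero => simp [prodMod]
  | succ n ih =>
    rw [Fin.prod_univ_castSucc, prodMod_succ]
    have h1 := h (Fin.last n)
    have h2 := ih (fun i : Fin n => g i.castSucc) fun i => h i.castSucc
    rw [Fin.val_last] at h1
    push_cast
    refine (Int.mod_modEq _ _).trans ?_
    rw [mul_comm]
    exact h2.mul h1

lemma abs_localFactor_le (p s e : ℕ) {z : ℤ} (hz : z ∈ Finset.Icc (-6 : ℤ) 6) :
    |localFactor p s e z| ≤ 6 ^ e := by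
  rw [Finset.mem_Icc] at hz
  have hc : |chi z| = 1 := by unfold chi; split_ifs <;> simp
  unfold localFactor
  split_ifs
  · rw [abs_mul, abs_pow, hc, one_pow, one_mul, abs_pow]
    exact pow_le_pow_left₀ (abs_nonneg _) (abs_le.2 hz) _
  · simp

/-- The vectors with coordinates between `-6` and `6`. They include all integral vectors of square
norm at most `40`. -/
def smallBox : Finset (Fin 16 → ℤ) := Fintype.piFinset fun _ => Finset.Icc (-6 : ℤ) 6

lemma card_smallBox : smallBox.card = 13 ^ 16 := by
  rw [smallBox, Fintype.card_piFinset_const, Int.card_Icc]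
  rfl

lemma mem_smallBox {x : Fin 16 → ℤ} (hx : x ∈ smallBox) (i : Fin 16) :
    x i ∈ Finset.Icc (-6 : ℤ) 6 := by
  rw [smallBox, Fintype.mem_piFinset] at hx
  exact hx i

lemma abs_prod_localFactor_le (p s e : Fin 16 → ℕ) (he : ∑ i, e i ≤ 12) {x : Fin 16 → ℤ}
    (hx : x ∈ smallBox) : |∏ i, localFactor (p i) (s i) (e i) (x i)| ≤ 6 ^ 12 := by
  rw [Finset.abs_prod]
  refine (Finset.prod_le_prod (fun i _ => abs_nonneg _)
    fun i _ => abs_localFactor_le _ _ _ (mem_smallBox hx i)).trans ?_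
  rw [Finset.prod_pow_eq_pow_sum]
  exact pow_le_pow_right₀ (by norm_num) he

/-- Evaluation of a sum of products of local factors over an integral shell. -/
lemma sum_prodSum_eq_kronDigit {U : Type*} [Fintype U] (hU : Fintype.card U = 64)
    (p s : U → Fin 16 → ℕ) (hp : ∀ u i, p u i < 2) (hs : ∀ u i, s u i < 2) {e : Fin 16 → ℕ}
    (he : ∑ i, e i ≤ 12) {N : ℕ} (hN : N ≤ 40) {q : ℕ}
    (hq : (q : ℤ) ≡ ∑ u, ∏ i, (localGen (p u i) (s u i) (e i) : ℤ) [ZMOD kronModulus]) :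
    ∑ u, prodSum N (fun i => localFactor (p u i) (s u i) (e i)) = kronDigit N q := by
  classical
  set F : Finset (U × (Fin 16 → ℤ)) := Finset.univ ×ˢ smallBox with hF
  let v : U × (Fin 16 → ℤ) → ℤ := fun y => ∏ i, localFactor (p y.1 i) (s y.1 i) (e i) (y.2 i)
  let d : U × (Fin 16 → ℤ) → ℕ := fun y => ∑ i, (y.2 i ^ 2).toNat
  have hd : ∀ y, (d y : ℤ) = ∑ i, y.2 i ^ 2 := fun y => by
    simp only [d, Nat.cast_sum]
    exact Finset.sum_congr rfl fun i _ => Int.toNat_of_nonneg (sq_nonneg _)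
  have hv : 2 * ∑ y ∈ F, |v y| < kronBase := by
    have h1 : ∀ y ∈ F, |v y| ≤ 6 ^ 12 := fun y hy =>
      abs_prod_localFactor_le _ _ _ he (Finset.mem_product.1 hy).2
    have h2 := Finset.sum_le_card_nsmul F (fun y => |v y|) _ h1
    rw [hF, Finset.card_product, Finset.card_univ, hU, card_smallBox, ← hF] at h2
    refine lt_of_le_of_lt (mul_le_mul_of_nonneg_left h2 zero_le_two) ?_
    norm_num [kronBase_eq]
  have hgen : (q : ℤ) ≡ ∑ y ∈ F, v y * (kronBase : ℤ) ^ d y [ZMOD kronModulus] := by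
    refine hq.trans ?_
    rw [hF, Finset.sum_product]
    refine Int.ModEq.sum fun u _ => ?_
    have h1 : ∑ x ∈ smallBox, v (u, x) * (kronBase : ℤ) ^ d (u, x) =
        ∏ i, ∑ z ∈ Finset.Icc (-6 : ℤ) 6,
          localFactor (p u i) (s u i) (e i) z * (kronBase : ℤ) ^ (z ^ 2).toNat := by
      rw [Finset.prod_univ_sum]
      refine Finset.sum_congr rfl fun x _ => ?_
      rw [Finset.prod_mul_distrib, Finset.prod_pow_eq_pow_sum]
    rw [h1]
    exact Int.ModEq.prod fun i _ => localGen_modEq (hp u i) (hs u i) (e i)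
  rw [← sum_filter_eq_kronDigit F v d hv hN hgen, Finset.sum_filter, hF, Finset.sum_product]
  refine Finset.sum_congr rfl fun u _ => ?_
  have hbox : smallBox = Fintype.piFinset fun _ => Finset.Icc (-((6 : ℕ) : ℤ)) (6 : ℕ) := by
    simp [smallBox]
  rw [prodSum, intShell_eq (R := 6) (by omega), Finset.sum_filter, ← hbox]
  refine Finset.sum_congr rfl fun x _ => ?_
  have h1 : (∑ i, x i ^ 2 = (N : ℤ)) ↔ d (u, x) = N := by
    have h2 : (d (u, x) : ℤ) = ∑ i, x i ^ 2 := hd (u, x)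
    rw [← h2, Nat.cast_inj]
  simp only [h1, v]

/-- The bits of the words of the Reed-Muller code, for quick evaluation. -/
def rmMask (t : ℕ) : ℕ :=
  (if t / 16 % 2 = 1 then 65535 else 0) ^^^ (if t % 2 = 1 then 43690 else 0) ^^^
    (if t / 2 % 2 = 1 then 52428 else 0) ^^^ (if t / 4 % 2 = 1 then 61680 else 0) ^^^
    (if t / 8 % 2 = 1 then 65280 else 0)

lemma rmMask_bit : ∀ t : Fin 32, ∀ i : Fin 16, rmMask t / 2 ^ (i : ℕ) % 2 = rmWord t i := by
  decide +kernel

/-- `∑ f 0 + ⋯ + f (n - 1)`. -/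
def sumUpTo (f : ℕ → ℕ) (n : ℕ) : ℕ := n.rec 0 fun i r => r + f i

lemma sumUpTo_eq (f : ℕ → ℕ) (n : ℕ) : sumUpTo f n = ∑ i : Fin n, f i := by
  induction n with
  | zero => rfl
  | succ n ih =>
    rw [Fin.sum_univ_castSucc]
    exact congrArg (· + f n) ih

/-- The product of the local generating functions over the Barnes-Wall lattice. -/
def bwTerm (e : ℕ → ℕ) (m s : ℕ) : ℕ := prodMod (fun i => fastLocalGen (m / 2 ^ i % 2) s (e i)) 16

/-- The product of the local generating functions over the rescaled dual. -/
def dualTerm (e : ℕ → ℕ) (m p : ℕ) : ℕ := prodMod (fun i => fastLocalGen p (m / 2 ^ i % 2) (e i)) 16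

/-- Twice the generating function of the moments of the Barnes-Wall lattice. -/
def bwGen (e : ℕ → ℕ) : ℕ := sumUpTo (fun t => bwTerm e (rmMask t) 0 + bwTerm e (rmMask t) 1) 32

/-- The generating function of the moments of the rescaled dual, multiplied by `32`. -/
def dualGen (e : ℕ → ℕ) : ℕ :=
  sumUpTo (fun t => dualTerm e (rmMask t) 0 + dualTerm e (rmMask t) 1) 32

lemma two_mul_moment_eq (e : ℕ → ℕ) (he : ∑ i : Fin 16, e i ≤ 12) {N : ℕ} (hN : N ≤ 40) :
    2 * moment IsBW N (fun i => e i) = kronDigit N (bwGen e) := by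
  rw [two_mul_moment]
  refine sum_prodSum_eq_kronDigit (e := fun i => e i) (by simp)
    (fun (u : Fin 32 × Fin 2) i => rmWord u.1 i)
    (fun (u : Fin 32 × Fin 2) _ => u.2)
    (fun u i => rmWord_lt _ _) (fun u _ => u.2.2) he hN ?_
  rw [bwGen, sumUpTo_eq, Fintype.sum_prod_type]
  push_cast
  refine Int.ModEq.sum fun t _ => ?_
  rw [Fin.sum_univ_two]
  refine Int.ModEq.add ?_ ?_ <;>
  exact prodMod_modEq _ 16 _ fun i => by rw [fastLocalGen_eq, rmMask_bit]; rfl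

lemma thirtytwo_mul_moment_eq (e : ℕ → ℕ) (he : ∑ i : Fin 16, e i ≤ 12) {N : ℕ} (hN : N ≤ 40) :
    32 * moment IsBWDual N (fun i => e i) = kronDigit N (dualGen e) := by
  rw [thirtytwo_mul_moment]
  refine sum_prodSum_eq_kronDigit (e := fun i => e i) (by simp)
    (fun (u : Fin 32 × Fin 2) _ => u.2)
    (fun u i => rmWord u.1 i)
    (fun u _ => u.2.2) (fun u i => rmWord_lt _ _) he hN ?_
  rw [dualGen, sumUpTo_eq, Fintype.sum_prod_type]
  push_cast
  refine Int.ModEq.sum fun t _ => ?_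
  rw [Fin.sum_univ_two]
  refine Int.ModEq.add ?_ ?_ <;>
  exact prodMod_modEq _ 16 _ fun i => by rw [fastLocalGen_eq, rmMask_bit]; rfl

/-! ### The moments of the short shells -/

/-- The exponent encoded by the hexadecimal digits of a number. -/
def codeExponent (c i : ℕ) : ℕ := c / 16 ^ i % 16

/-- The code of the exponent `listExponent l`. -/
def listCode (l : List (Fin 16)) : ℕ := (l.map fun i => 2 * 16 ^ (i : ℕ)).sum

/-- The code of the exponent which is `1` on the hyperplane `i ≥ 8` and `0` elsewhere. -/
def hyperplaneCode : ℕ := 0x1111111100000000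

/-- The relation `shortMoment k w δ e = c * ∏ evenFactor (e i)` for the exponent `e` with the given
code, multiplied by `32`, in terms of the digits of `bwGen e` (twice a moment) and `dualGen e` (`32`
times a moment). -/
def momentCheck (k : ℕ) (w : Fin 3 → ℕ) (δ c code : ℕ) : Bool :=
  let e := codeExponent code
  let b := bwGen e
  let d := if δ = 0 then 0 else dualGen e
  decide (w 0 * (2 ^ k * 16 * kronDigit 8 b + δ * kronDigit 16 d) +
    w 1 * (2 ^ k * 16 * kronDigit 12 b + δ * kronDigit 24 d) +
    w 2 * (2 ^ k * 16 * kronDigit 20 b + δ * kronDigit 40 d) =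
      32 * c * ((List.range 16).map fun i => evenFactor (e i)).prod)

/-- The combination of the moments of the six shells `(BW₁₆)ₘ` and `(BW₁₆')ₘ`, `m = 4, 6, 10`, for
the weights `w j`; the dual lattice occurs for `δ = 1` and is absent for `δ = 0`. The factor `2 ^ k`
accounts, in degree `2k`, for the different scales of the two integral coordinate systems: the shell
`m` consists of the integral vectors of square norm `2m`, and `4m` for the dual. -/
def shortMoment (k : ℕ) (w : Fin 3 → ℕ) (δ : ℕ) (e : Fin 16 → ℕ) : ℤ :=
  w 0 * (2 ^ k * moment IsBW 8 e + δ * moment IsBWDual 16 e) +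
  w 1 * (2 ^ k * moment IsBW 12 e + δ * moment IsBWDual 24 e) +
  w 2 * (2 ^ k * moment IsBW 20 e + δ * moment IsBWDual 40 e)

lemma shortMoment_of_check {k : ℕ} {w : Fin 3 → ℕ} {δ c code : ℕ}
    (h : momentCheck k w δ c code = true) {e : Fin 16 → ℕ}
    (he : ∀ i : Fin 16, codeExponent code i = e i) (hsum : ∑ i, e i ≤ 12) :
    shortMoment k w δ e = c * ∏ i, (evenFactor (e i) : ℤ) := by
  obtain rfl : e = fun i : Fin 16 => codeExponent code i := funext fun i => (he i).symm
  rw [momentCheck, decide_eq_true_eq] at h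
  have hprod : (((List.range 16).map fun i => evenFactor (codeExponent code i)).prod : ℕ) =
      ∏ i : Fin 16, evenFactor (codeExponent code i) := by
    rw [Fin.prod_univ_def, ← List.map_coe_finRange_eq_range, List.map_map]
    rfl
  rw [hprod, ← two_mul_moment_eq _ hsum (by norm_num), ← two_mul_moment_eq _ hsum (by norm_num),
    ← two_mul_moment_eq _ hsum (by norm_num)] at h
  rw [shortMoment]
  rcases Nat.eq_zero_or_pos δ with rfl | hδ
  · push_cast at h ⊢
    refine mul_left_cancel₀ (by norm_num : (32 : ℤ) ≠ 0) ?_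
    linear_combination h
  · rw [if_neg hδ.ne', ← thirtytwo_mul_moment_eq _ hsum (by norm_num),
      ← thirtytwo_mul_moment_eq _ hsum (by norm_num),
      ← thirtytwo_mul_moment_eq _ hsum (by norm_num)] at h
    push_cast at h ⊢
    refine mul_left_cancel₀ (by norm_num : (32 : ℤ) ≠ 0) ?_
    linear_combination h

lemma mem_growthLists_four (m l : List (Fin 16)) : l ++ m ∈ growthLists m.length 4 l := by
  induction m generalizing l with
  | nil => simp [growthLists]
  | cons i m ih =>
    rw [List.length_cons, growthLists, List.mem_flatMap]
    refine ⟨i, by simp, ?_⟩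
    rw [if_neg (by omega)]
    simpa using ih (l ++ [i])

/-- The lists of `n` positions which start with `0` or `8`. -/
def oddLists (n : ℕ) : List (List (Fin 16)) :=
  (growthLists n 4 []).filter fun l => ∀ i ∈ l.head?, i = 0 ∨ i = 8

/-- The relation `shortMoment k w δ e = c * ∏ evenFactor (e i)` has to be checked for the exponents
in `forall_exponents` only. -/
theorem shortMoment_eq {k : ℕ} (hk : k + 1 ≤ 6) (w : Fin 3 → ℕ) (δ c : ℕ)
    (h1 : ∀ l ∈ growthLists k 0 [0], ∀ i : Fin 16,
      codeExponent (listCode l) i = listExponent l i)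
    (h2 : ∀ x ∈ ((growthLists k 0 [0]).map listCode).dedup, momentCheck (k + 1) w δ c x = true)
    (h3 : ∀ l ∈ oddLists (k - 3), ∀ i : Fin 16,
      codeExponent (hyperplaneCode + listCode l) i = rmWord 8 i + listExponent l i)
    (h4 : ∀ x ∈ ((oddLists (k - 3)).map listCode).dedup,
      momentCheck (k + 1) w δ c (hyperplaneCode + x) = true)
    (e : Fin 16 → ℕ) (he : ∑ i, e i = 2 * (k + 1)) :
    shortMoment (k + 1) w δ e = c * ∏ i, (evenFactor (e i) : ℤ) := by
  suffices H : ∑ i, e i = 2 * (k + 1) →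
      shortMoment (k + 1) w δ e = c * ∏ i, (evenFactor (e i) : ℤ) from H he
  refine forall_exponents (P := fun e => ∑ i, e i = 2 * (k + 1) →
      shortMoment (k + 1) w δ e = c * ∏ i, (evenFactor (e i) : ℤ)) (by omega) ?_ ?_ ?_ ?_ e he
  · intro t v hs e h he
    have hprod : ∏ i, (evenFactor (e (shear t v i)) : ℤ) = ∏ i, (evenFactor (e i) : ℤ) :=
      Equiv.prod_comp (shear_involutive hs).toPerm fun i => (evenFactor (e i) : ℤ)
    have hsum : ∑ i, e (shear t v i) = ∑ i, e i := Equiv.sum_comp (shear_involutive hs).toPerm e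
    rw [← hprod, ← h (hsum.trans he), shortMoment, shortMoment]
    simp only [moment_comp_shear hs (fun x (hx : IsBW x) => hx.comp_shear hs),
      moment_comp_shear hs (fun x (hx : IsBWDual x) => hx.comp_shear hs)]
  · intro e he _
    have h0 : ∃ i, ¬ Even (e i) := by
      by_contra! hev
      exact he ⟨0, fun i => by rw [rmWord_zero]; exact Nat.even_iff.1 (hev i)⟩
    obtain ⟨i, hi⟩ := h0
    rw [Finset.prod_eq_zero (Finset.mem_univ i) (by simp [evenFactor, hi])]
    simp [shortMoment, moment_eq_zero he, moment_dual_eq_zero he]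
  · intro l hl he
    exact shortMoment_of_check
      (h2 _ (List.mem_dedup.2 (List.mem_map_of_mem hl))) (h1 l hl)
      (he.le.trans (by omega))
  · intro l hl hl0 he
    have hmem : l ∈ oddLists (k - 3) := by
      refine List.mem_filter.2 ⟨?_, decide_eq_true hl0⟩
      have := mem_growthLists_four l []
      rwa [List.nil_append, show l.length = k - 3 by omega] at this
    exact shortMoment_of_check
      (h4 _ (List.mem_dedup.2 (List.mem_map_of_mem hmem))) (h3 l hmem)
      (he.le.trans (by omega))

/-- The relation behind the strength `9` for the shells `4, 6` of the Barnes-Wall lattice. Here and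
below the weights solve the linear equations which express that the moments are proportional to
those of the sphere. -/
theorem shortMoment_eight (e : Fin 16 → ℕ) (he : ∑ i, e i = 8) :
    shortMoment 4 ![16, 1, 0] 0 e = 12288 * ∏ i, (evenFactor (e i) : ℤ) := by
  have h := shortMoment_eq (k := 3) (by norm_num) ![16, 1, 0] 0 12288 (by decide +kernel)
    (by decide +kernel) (by decide +kernel) (by decide +kernel) e he
  rw [h, Nat.cast_ofNat]

/-- The relation behind the strength `11` for the shells `4, 6` of the two lattices. -/
theorem shortMoment_ten (e : Fin 16 → ℕ) (he : ∑ i, e i = 10) :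
    shortMoment 5 ![24, 1, 0] 1 e = 12288 * ∏ i, (evenFactor (e i) : ℤ) := by
  have h := shortMoment_eq (k := 4) (by norm_num) ![24, 1, 0] 1 12288 (by decide +kernel)
    (by decide +kernel) (by decide +kernel) (by decide +kernel) e he
  rw [h, Nat.cast_ofNat]

/-- The relation behind the strength `13` for the shells `4, 6, 10` of the two lattices. -/
theorem shortMoment_twelve (e : Fin 16 → ℕ) (he : ∑ i, e i = 12) :
    shortMoment 6 ![2560, 60, 1] 1 e = 3932160 * ∏ i, (evenFactor (e i) : ℤ) := by
  have h := shortMoment_eq (k := 5) (by norm_num) ![2560, 60, 1] 1 3932160 (by decide +kernel)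
    (by decide +kernel) (by decide +kernel) (by decide +kernel) e he
  rw [h, Nat.cast_ofNat]

lemma card_filter_intShell {N : ℕ} (P : (Fin 16 → ℤ) → Prop) [DecidablePred P] :
    (((intShell N).filter P).card : ℤ) = moment P N fun _ => 0 := by
  simp only [moment, pow_zero, Finset.prod_const_one, Finset.sum_const, nsmul_eq_mul, mul_one]
  congr!

lemma moment_zero_of_digit {N v : ℕ} (hN : N ≤ 40)
    (h : kronDigit N (bwGen fun _ => 0) = 2 * v) : moment IsBW N (fun _ => 0) = v := by
  have h1 := two_mul_moment_eq (fun _ => 0) (by simp) hN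
  exact mul_left_cancel₀ two_ne_zero (h1.trans h)

lemma moment_dual_zero_of_digit {N v : ℕ} (hN : N ≤ 40)
    (h : kronDigit N (dualGen fun _ => 0) = 32 * v) : moment IsBWDual N (fun _ => 0) = v := by
  have h1 := thirtytwo_mul_moment_eq (fun _ => 0) (by simp) hN
  exact mul_left_cancel₀ (by norm_num) (h1.trans h)

/-! ### The isometry given by the Hadamard matrix of order four -/

/-- The position with last two binary digits `j` and first two binary digits `b`. -/
def pos (b j : Fin 4) : Fin 16 := ⟨4 * b + j, by omega⟩

/-- The block `b` of the position `pos b j`. -/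
def posBlock (i : Fin 16) : Fin 4 := ⟨i / 4, by omega⟩

/-- The place `j` of the position `pos b j` in its block. -/
def posPlace (i : Fin 16) : Fin 4 := ⟨i % 4, by omega⟩

/-- The entries of the Hadamard matrix of order `4`. -/
def hadSign (a j : Fin 4) : ℤ := if (a &&& j) = 1 ∨ (a &&& j) = 2 then -1 else 1

/-- Twice the isometry which acts by half of the Hadamard matrix of order `4` on every block. -/
def had (x : Fin 16 → ℤ) (i : Fin 16) : ℤ := ∑ j, hadSign (posPlace i) j * x (pos (posBlock i) j)

lemma posBlock_pos : ∀ b j, posBlock (pos b j) = b := by decide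

lemma posPlace_pos : ∀ b j, posPlace (pos b j) = j := by decide

lemma pos_posBlock : ∀ i, pos (posBlock i) (posPlace i) = i := by decide

lemma sum_pos (f : Fin 16 → ℤ) : ∑ i, f i = ∑ b, ∑ j, f (pos b j) := by
  let σ : Fin 4 × Fin 4 ≃ Fin 16 :=
    { toFun := fun y => pos y.1 y.2
      invFun := fun i => (posBlock i, posPlace i)
      left_inv := fun y => Prod.ext (posBlock_pos _ _) (posPlace_pos _ _)
      right_inv := pos_posBlock }
  rw [← Equiv.sum_comp σ, Fintype.sum_prod_type]
  rfl

lemma had_pos (x : Fin 16 → ℤ) (b a : Fin 4) :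
    had x (pos b a) = ∑ j, hadSign a j * x (pos b j) := by
  rw [had, posBlock_pos, posPlace_pos]

lemma had_had (x : Fin 16 → ℤ) (i : Fin 16) : had (had x) i = 4 * x i := by
  have key : ∀ a l : Fin 4, ∑ j, hadSign a j * hadSign j l = if l = a then 4 else 0 := by decide
  conv_lhs => rw [had]
  simp_rw [had_pos, Finset.mul_sum, ← mul_assoc]
  rw [Finset.sum_comm]
  simp_rw [← Finset.sum_mul, key, ite_mul, zero_mul]
  rw [Finset.sum_ite_eq' Finset.univ, if_pos (Finset.mem_univ _), pos_posBlock]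

lemma sum_had_sq (x : Fin 16 → ℤ) : ∑ i, had x i ^ 2 = 4 * ∑ i, x i ^ 2 := by
  rw [sum_pos, sum_pos, Finset.mul_sum]
  refine Finset.sum_congr rfl fun b _ => ?_
  simp_rw [had_pos, Fin.sum_univ_four]
  simp [hadSign]
  ring

lemma sum_had (x : Fin 16 → ℤ) : ∑ i, had x i = 4 * ∑ b, x (pos b 0) := by
  rw [sum_pos, Finset.mul_sum]
  refine Finset.sum_congr rfl fun b _ => ?_
  simp_rw [had_pos, Fin.sum_univ_four]
  simp [hadSign]
  ring

lemma had_add (x y : Fin 16 → ℤ) (c : ℤ) (i : Fin 16) :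
    had (fun i => x i + c * y i) i = had x i + c * had y i := by
  simp only [had, Finset.mul_sum, ← Finset.sum_add_distrib]
  exact Finset.sum_congr rfl fun j _ => by ring

/-- On words of the Reed-Muller code the isometry is integral; its value, modified by a word which
is constant on the blocks, is again in the code modulo `2`. -/
lemma had_rmWord : ∀ t : Fin 32, (∀ i, 2 ∣ had (fun i => rmWord t i) i) ∧
    (2 ∣ ∑ b, (rmWord t (pos b 0) : ℤ)) ∧ ∀ κ : Fin 4 → Fin 2, Even (∑ b, (κ b : ℕ)) →
      ∃ t', ∀ i, (had (fun i => rmWord t i) i / 2 + (κ (posBlock i) : ℕ)) % 2 = rmWord t' i := by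
  decide +kernel

lemma IsBW.had_half {x : Fin 16 → ℤ} (hx : IsBW x) :
    (∀ i, 2 ∣ had x i) ∧ IsBW fun i => had x i / 2 := by
  obtain ⟨t, k, hk, hke⟩ := hx.exists_eq
  obtain ⟨h1, h2, h3⟩ := had_rmWord t
  have hhad : ∀ i, had x i = had (fun i => rmWord t i) i + 2 * had k i := fun i => by
    rw [← had_add]; congr 1; exact funext hk
  have hdvd : ∀ i, 2 ∣ had x i := fun i => by
    rw [hhad]; exact dvd_add (h1 i) (dvd_mul_right _ _)
  refine ⟨hdvd, ?_, ?_⟩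
  · -- Modulo `2` the image of `k` is constant on the blocks.
    have hmod : ∀ i, had k i % 2 = (∑ j, k (pos (posBlock i) j)) % 2 := fun i => by
      refine (Int.ModEq.sum fun j _ => ?_ : _ ≡ _ [ZMOD 2])
      unfold hadSign
      split_ifs
      · rw [Int.modEq_iff_dvd]; exact ⟨k (pos (posBlock i) j), by ring⟩
      · rw [one_mul]
    let κ : Fin 4 → Fin 2 := fun b => ⟨((∑ j, k (pos b j)) % 2).toNat, by omega⟩
    have hκ : ∀ b, ((κ b : ℕ) : ℤ) = (∑ j, k (pos b j)) % 2 := fun b => by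
      simp only [κ]; omega
    obtain ⟨t', ht'⟩ := h3 κ (by
      rw [sum_pos] at hke
      rw [← Int.even_coe_nat, Nat.cast_sum]
      simp_rw [hκ]
      rw [Int.even_iff] at hke ⊢
      rw [← hke]
      exact (Int.ModEq.sum fun b _ => Int.mod_modEq _ _ : _ ≡ _ [ZMOD 2]))
    refine ⟨t', fun i => ?_⟩
    have h4 := h1 i
    rw [← ht' i, hκ, ← hmod]
    show had x i / 2 % 2 = _
    rw [hhad]
    omega
  · have h4 : 2 * ∑ i, had x i / 2 = 4 * ∑ b, x (pos b 0) := by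
      rw [← sum_had, Finset.mul_sum]
      exact Finset.sum_congr rfl fun i _ => Int.mul_ediv_cancel' (hdvd i)
    have h5 : ∑ b, x (pos b 0) = ∑ b, (rmWord t (pos b 0) : ℤ) + 2 * ∑ b, k (pos b 0) := by
      rw [Finset.mul_sum, ← Finset.sum_add_distrib]
      exact Finset.sum_congr rfl fun b _ => hk _
    show 4 ∣ ∑ i, had x i / 2
    omega

/-! ### The moments of degree six of all shells -/

/-- The moments of the monomial which is the product of the coordinates at the positions in a list.
-/
def listMoment (N : ℕ) (l : List (Fin 16)) : ℤ := moment IsBW N fun i => l.count i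

open Classical in
lemma listMoment_eq (N : ℕ) (l : List (Fin 16)) :
    listMoment N l = ∑ x ∈ (intShell N).filter IsBW, (l.map x).prod := by
  refine Finset.sum_congr rfl fun x _ => ?_
  rw [Finset.prod_list_map_count]
  refine (Finset.prod_subset (Finset.subset_univ _) fun i _ hi => ?_).symm
  rw [List.mem_toFinset] at hi
  dsimp only
  rw [List.count_eq_zero_of_not_mem hi, pow_zero]

open Classical in
lemma pow_mul_listMoment (N : ℕ) (l : List (Fin 16)) :
    2 ^ l.length * listMoment N l =
      ∑ x ∈ (intShell N).filter IsBW, (l.map (had x)).prod := by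
  rw [listMoment_eq, Finset.mul_sum]
  have hmem : ∀ x ∈ (intShell N).filter IsBW, (fun i => had x i / 2) ∈
      (intShell N).filter IsBW := fun x hx => by
    rw [Finset.mem_filter, mem_intShell] at hx ⊢
    obtain ⟨h1, h2⟩ := hx.2.had_half
    refine ⟨?_, h2⟩
    have h3 : 4 * ∑ i, (had x i / 2) ^ 2 = 4 * ∑ i, x i ^ 2 := by
      rw [← sum_had_sq x, Finset.mul_sum]
      refine Finset.sum_congr rfl fun i _ => ?_
      obtain ⟨z, hz⟩ := h1 i
      rw [hz, Int.mul_ediv_cancel_left _ two_ne_zero]; ring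
    rw [← hx.1]; omega
  have hinv : ∀ x ∈ (intShell N).filter IsBW,
      (fun i => had (fun i => had x i / 2) i / 2) = x := fun x hx => by
    obtain ⟨h1, -⟩ := (Finset.mem_filter.1 hx).2.had_half
    ext i
    have h2 : 2 * had (fun i => had x i / 2) i = 4 * x i := by
      rw [← had_had, had, had, Finset.mul_sum]
      refine Finset.sum_congr rfl fun j _ => ?_
      obtain ⟨z, hz⟩ := h1 (pos (posBlock i) j)
      rw [hz, Int.mul_ediv_cancel_left _ two_ne_zero]; ring
    omega
  refine Finset.sum_nbij' (fun x i => had x i / 2) (fun x i => had x i / 2) hmem hmem hinv hinv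
    fun x hx => ?_
  have hl : ∀ l : List (Fin 16), 2 ^ l.length * (l.map x).prod =
      (l.map (had fun i => had x i / 2)).prod := by
    intro l
    induction l with
    | nil => simp
    | cons i l ih =>
      have h2 := congrFun (hinv x hx) i
      have h3 := (hmem x hx |> Finset.mem_filter.1).2.had_half.1 i
      have h4 : had (fun i => had x i / 2) i = 2 * x i := by
        have h2' : had (fun i => had x i / 2) i / 2 = x i := h2
        omega
      rw [List.map_cons, List.map_cons, List.prod_cons, List.prod_cons, List.length_cons, ← ih, h4]
      ring
  exact hl l

/-- The monomials in the expansion of `(∑ j, x (pos b₁ j)) ⋯ (∑ j, x (pos bₙ j))`. -/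
def expand : List (Fin 4) → List (List (Fin 16))
  | [] => [[]]
  | b :: l => (List.finRange 4).flatMap fun j => (expand l).map (pos b j :: ·)

lemma prod_had_eq (x : Fin 16 → ℤ) (l : List (Fin 4)) :
    (l.map fun b => had x (pos b 0)).prod = ((expand l).map fun m => (m.map x).prod).sum := by
  induction l with
  | nil => simp [expand]
  | cons b l ih =>
    have h0 : had x (pos b 0) = ((List.finRange 4).map fun j => x (pos b j)).sum := by
      have hsign : ∀ j, hadSign 0 j = 1 := by decide
      simp_rw [had_pos, hsign, one_mul]
      rw [Fin.sum_univ_def]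
    rw [List.map_cons, List.prod_cons, ih, h0, expand]
    generalize List.finRange 4 = js
    induction js with
    | nil => simp
    | cons j js ihj =>
      rw [List.map_cons, List.sum_cons, add_mul, ihj, List.flatMap_cons, List.map_append,
        List.sum_append, List.map_map]
      congr 1
      rw [← List.sum_map_mul_left]
      congr 1

lemma pow_mul_listMoment_pos (N : ℕ) (l : List (Fin 4)) :
    2 ^ l.length * listMoment N (l.map fun b => pos b 0) =
      ((expand l).map (listMoment N)).sum := by
  classical
  have h := pow_mul_listMoment N (l.map fun b => pos b 0)
  rw [List.length_map] at h
  rw [h]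
  have h1 : ∀ x : Fin 16 → ℤ, ((l.map fun b => pos b 0).map (had x)).prod =
      ((expand l).map fun m => (m.map x).prod).sum := fun x => by
    rw [List.map_map]; exact prod_had_eq x l
  simp_rw [h1]
  rw [show listMoment N = _ from funext (listMoment_eq N)]
  generalize expand l = L
  induction L with
  | nil => simp
  | cons m L ih => simp [Finset.sum_add_distrib, ih]

/-- The sum of the squares of an even exponent, and `0` for other exponents. In degree `6` it
separates the orbits of even exponents. -/
def sqType (e : Fin 16 → ℕ) : ℕ := if ∀ i, e i % 2 = 0 then ∑ i, e i ^ 2 else 0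

/-- One of three values, according to the type of an exponent of degree `6`. -/
def typeValue (A B C : ℤ) (n : ℕ) : ℤ :=
  if n = 36 then A else if n = 20 then B else if n = 12 then C else 0

lemma sqType_shear {t : Fin 32} {v : Fin 16} (hs : IsShear t v) (e : Fin 16 → ℕ) :
    sqType (fun i => e (shear t v i)) = sqType e := by
  have hall : (∀ i, e (shear t v i) % 2 = 0) ↔ ∀ i, e i % 2 = 0 :=
    ⟨fun h i => by have := h (shear t v i); rwa [shear_involutive hs] at this, fun h i => h _⟩
  have hsum : ∑ i, e (shear t v i) ^ 2 = ∑ i, e i ^ 2 :=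
    Equiv.sum_comp (shear_involutive hs).toPerm fun i => e i ^ 2
  simp only [sqType, hall, hsum]

lemma growthLists_two :
    growthLists 2 0 [0] = [[0, 0, 0], [0, 0, 1], [0, 1, 0], [0, 1, 1], [0, 1, 2]] := by
  decide +kernel

lemma prod_evenFactor_eq_typeValue (e : Fin 16 → ℕ) (he : ∑ i, e i = 6) :
    ∏ i, (evenFactor (e i) : ℤ) = typeValue 120 24 8 (sqType e) := by
  refine forall_exponents (P := fun e => ∏ i, (evenFactor (e i) : ℤ) =
    typeValue 120 24 8 (sqType e)) (k := 2) (by norm_num) ?_ ?_ ?_ ?_ e he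
  · intro t v hs e h
    have hprod : ∏ i, (evenFactor (e (shear t v i)) : ℤ) = ∏ i, (evenFactor (e i) : ℤ) :=
      Equiv.prod_comp (shear_involutive hs).toPerm fun i => (evenFactor (e i) : ℤ)
    exact hprod.symm.trans (h.trans (congrArg _ (sqType_shear hs e)))
  · intro e he
    have h0 : ¬ ∀ i, e i % 2 = 0 := fun hev => he ⟨0, fun i => by rw [rmWord_zero]; exact hev i⟩
    rw [sqType, if_neg h0]
    push Not at h0
    obtain ⟨i, hi⟩ := h0
    rw [Finset.prod_eq_zero (Finset.mem_univ i) (by simp [evenFactor, Nat.even_iff, hi])]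
    rfl
  · rw [growthLists_two]
    decide +kernel
  · intro l hl _
    omega

lemma moment_eq_typeValue (N : ℕ) (e : Fin 16 → ℕ) (he : ∑ i, e i = 6) :
    moment IsBW N e = typeValue (moment IsBW N (listExponent [0, 0, 0]))
      (moment IsBW N (listExponent [0, 0, 1])) (moment IsBW N (listExponent [0, 1, 2]))
      (sqType e) := by
  refine forall_exponents (P := fun e => moment IsBW N e =
    typeValue (moment IsBW N (listExponent [0, 0, 0]))
      (moment IsBW N (listExponent [0, 0, 1])) (moment IsBW N (listExponent [0, 1, 2]))
      (sqType e)) (k := 2) (by norm_num) ?_ ?_ ?_ ?_ e he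
  · intro t v hs e h
    rwa [sqType_shear hs, moment_comp_shear hs fun x (hx : IsBW x) => hx.comp_shear hs] at h
  · intro e he
    have h0 : ¬ ∀ i, e i % 2 = 0 := fun hev => he ⟨0, fun i => by rw [rmWord_zero]; exact hev i⟩
    rw [moment_eq_zero he, sqType, if_neg h0]
    rfl
  · rw [growthLists_two]
    have h000 : sqType (listExponent [0, 0, 0]) = 36 := by decide
    have h001 : sqType (listExponent [0, 0, 1]) = 20 := by decide
    have h012 : sqType (listExponent [0, 1, 2]) = 12 := by decide
    have e1 : listExponent [0, 1, 0] = listExponent [0, 0, 1] := by decide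
    have e2 : (fun i => listExponent [0, 1, 1] (shear 16 1 i)) = listExponent [0, 0, 1] := by
      decide
    have h011 : sqType (listExponent [0, 1, 1]) = 20 := by decide
    have hs : IsShear 16 1 := by decide
    have e3 := moment_comp_shear hs (fun x (hx : IsBW x) => hx.comp_shear hs) N
      (listExponent [0, 1, 1])
    rw [e2] at e3
    intro l hmem
    simp only [List.mem_cons, List.not_mem_nil, or_false] at hmem
    rcases hmem with rfl | rfl | rfl | rfl | rfl
    · rw [h000]; rfl
    · rw [h001]; rfl
    · rw [e1, h001]; rfl
    · rw [h011, ← e3]; rfl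
    · rw [h012]; rfl
  · intro l hl _
    omega

lemma sum_map_typeValue (A B C : ℤ) (L : List ℕ) :
    (L.map (typeValue A B C)).sum = L.count 36 * A + L.count 20 * B + L.count 12 * C := by
  induction L with
  | nil => simp
  | cons n L ih =>
    rw [List.map_cons, List.sum_cons, ih]
    simp only [List.count_cons, typeValue, beq_iff_eq]
    split_ifs <;> first | omega | (push_cast; ring)

lemma length_of_mem_expand (l : List (Fin 4)) : ∀ m ∈ expand l, m.length = l.length := by
  induction l with
  | nil => simp [expand]
  | cons b l ih =>
    intro m hm
    simp only [expand, List.mem_flatMap, List.mem_map] at hm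
    obtain ⟨j, -, m', hm', rfl⟩ := hm
    simp [ih m' hm']

/-- Comparison of a moment with its image under the isometry. -/
lemma expand_relation (N : ℕ) (l : List (Fin 4)) (hl : l.length = 6) {a b c : ℕ}
    (h : ∀ L, L = (expand l).map (fun m => sqType fun i => m.count i) →
      L.count 36 = a ∧ L.count 20 = b ∧ L.count 12 = c) :
    64 * listMoment N (l.map fun b => pos b 0) =
      a * moment IsBW N (listExponent [0, 0, 0]) + b * moment IsBW N (listExponent [0, 0, 1]) +
        c * moment IsBW N (listExponent [0, 1, 2]) := by
  obtain ⟨ha, hb, hc⟩ := h _ rfl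
  have h1 := pow_mul_listMoment_pos N l
  rw [hl] at h1
  rw [← ha, ← hb, ← hc, ← sum_map_typeValue, List.map_map]
  refine (by norm_num at h1; exact h1 : 64 * listMoment N (l.map fun b => pos b 0) =
      ((expand l).map (listMoment N)).sum).trans ?_
  congr 1
  refine List.map_congr_left fun m hm => ?_
  refine moment_eq_typeValue N _ ?_
  have h2 := Multiset.sum_count_eq_card (s := Finset.univ) (m := (m : Multiset (Fin 16))) (by simp)
  rw [Multiset.coe_card, length_of_mem_expand l m hm, hl] at h2
  simpa only [Multiset.coe_count] using h2

lemma counts_expand_zero : ∀ L,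
    L = (expand [0, 0, 0, 0, 0, 0]).map (fun m => sqType fun i => m.count i) →
      L.count 36 = 4 ∧ L.count 20 = 180 ∧ L.count 12 = 360 := by
  rintro _ rfl
  decide +kernel

lemma counts_expand_zero_one : ∀ L,
    L = (expand [0, 0, 0, 0, 1, 1]).map (fun m => sqType fun i => m.count i) →
      L.count 36 = 0 ∧ L.count 20 = 16 ∧ L.count 12 = 144 := by
  rintro _ rfl
  decide +kernel

/-- The two relations given by the isometry make the moments of degree `6` of every shell
proportional to those of the sphere. -/
theorem moment_six (N : ℕ) :
    ∃ c : ℤ, ∀ e : Fin 16 → ℕ, ∑ i, e i = 6 →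
      8 * moment IsBW N e = c * ∏ i, (evenFactor (e i) : ℤ) := by
  set A := moment IsBW N (listExponent [0, 0, 0]) with hA
  set B := moment IsBW N (listExponent [0, 0, 1]) with hB
  set C := moment IsBW N (listExponent [0, 1, 2]) with hC
  have h1 := expand_relation N [0, 0, 0, 0, 0, 0] rfl (counts_expand_zero)
  have h2 := expand_relation N [0, 0, 0, 0, 1, 1] rfl (counts_expand_zero_one)
  have e1 : listMoment N ([0, 0, 0, 0, 0, 0].map fun b => pos b 0) = A := by
    rw [listMoment, hA]; congr 1; decide
  have e2 : listMoment N ([0, 0, 0, 0, 1, 1].map fun b => pos b 0) = B := by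
    rw [listMoment, moment_eq_typeValue N _ (by decide),
      (by decide : sqType (fun i => ([0, 0, 0, 0, 1, 1].map fun b => pos b 0).count i) = 20)]
    rfl
  rw [e1, ← hA, ← hB, ← hC] at h1
  rw [e2, ← hA, ← hB, ← hC] at h2
  push_cast at h1 h2
  have hBC : B = 3 * C := by omega
  have hAC : A = 15 * C := by omega
  refine ⟨C, fun e he => ?_⟩
  rw [moment_eq_typeValue N e he, ← hA, ← hB, ← hC, prod_evenFactor_eq_typeValue e he, hAC, hBC]
  unfold typeValue
  split_ifs <;> ring

/-! ### The shells as scaled sets of integral vectors -/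

open Classical in
/-- The set of the vectors `s x`, for the integral vectors `x` of norm `N` with the property `P`. -/
def scaledShell (P : (Fin 16 → ℤ) → Prop) (N : ℕ) (s : ℝ) : Finset (EuclideanSpace ℝ (Fin 16)) :=
  ((intShell N).filter P).image fun x => WithLp.toLp 2 fun i => s * x i

lemma mem_scaledShell {P : (Fin 16 → ℤ) → Prop} {N : ℕ} {s : ℝ} {v : EuclideanSpace ℝ (Fin 16)} :
    v ∈ scaledShell P N s ↔ ∃ x : Fin 16 → ℤ, ∑ i, x i ^ 2 = N ∧ P x ∧ ∀ i, v i = s * x i := by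
  simp only [scaledShell, Finset.mem_image, Finset.mem_filter, mem_intShell, and_assoc]
  refine exists_congr fun x => and_congr_right fun _ => and_congr_right fun _ => ⟨?_, fun h => ?_⟩
  · rintro rfl i
    rfl
  · ext i
    exact (h i).symm

lemma scaledShell_injective {s : ℝ} (hs : s ≠ 0) :
    Function.Injective fun (x : Fin 16 → ℤ) =>
      (WithLp.toLp 2 fun i => s * (x i : ℝ) : EuclideanSpace ℝ (Fin 16)) := by
  intro x y h
  ext i
  have h1 : s * (x i : ℝ) = s * y i := congrArg (fun v : EuclideanSpace ℝ (Fin 16) => v i) h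
  exact_mod_cast mul_left_cancel₀ hs h1

lemma card_scaledShell (P : (Fin 16 → ℤ) → Prop) (N : ℕ) {s : ℝ} (hs : s ≠ 0) :
    ((scaledShell P N s).card : ℤ) = moment P N fun _ => 0 := by
  classical
  rw [scaledShell, Finset.card_image_of_injective _ (scaledShell_injective hs),
    card_filter_intShell]

lemma sum_scaledShell (P : (Fin 16 → ℤ) → Prop) (N : ℕ) {s : ℝ} (hs : s ≠ 0) (a : Fin 16 → ℕ) :
    ∑ x ∈ scaledShell P N s, ∏ i, x i ^ a i = s ^ (∑ i, a i) * moment P N a := by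
  classical
  rw [scaledShell, Finset.sum_image fun x _ y _ h => scaledShell_injective hs h, moment,
    Int.cast_sum, Finset.mul_sum]
  refine Finset.sum_congr rfl fun x _ => ?_
  rw [← Finset.prod_pow_eq_pow_sum, Int.cast_prod, ← Finset.prod_mul_distrib]
  refine Finset.prod_congr rfl fun i _ => ?_
  rw [Int.cast_pow, ← mul_pow]

lemma neg_mem_scaledShell {P : (Fin 16 → ℤ) → Prop} (hP : ∀ x, P x → P (-x)) {N : ℕ} {s : ℝ}
    {v : EuclideanSpace ℝ (Fin 16)} (hv : v ∈ scaledShell P N s) : -v ∈ scaledShell P N s := by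
  rw [mem_scaledShell] at hv ⊢
  obtain ⟨x, hx, hPx, hxv⟩ := hv
  exact ⟨-x, by simpa using hx, hP x hPx, fun i => by simp [hxv i]⟩

lemma mem_normSphere_iff {v : EuclideanSpace ℝ (Fin 16)} {r : ℝ} :
    v ∈ normSphere 16 r ↔ ∑ i, v i ^ 2 = r := by
  rw [normSphere, Set.mem_ofPred_eq, real_inner_self_eq_norm_sq, EuclideanSpace.real_norm_sq_eq]

lemma mem_normSphere_of_mem_scaledShell {P : (Fin 16 → ℤ) → Prop} {N : ℕ} {s : ℝ}
    {v : EuclideanSpace ℝ (Fin 16)} (hv : v ∈ scaledShell P N s) :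
    v ∈ normSphere 16 (s ^ 2 * N) := by
  obtain ⟨x, hx, -, hxv⟩ := mem_scaledShell.1 hv
  rw [mem_normSphere_iff]
  simp_rw [hxv, mul_pow, ← Finset.mul_sum]
  rw [← Int.cast_natCast (R := ℝ) N, ← hx]
  push_cast
  rfl

lemma shell_eq_scaledShell {E : Set (EuclideanSpace ℝ (Fin 16))} {P : (Fin 16 → ℤ) → Prop} {s : ℝ}
    (hs : s ≠ 0) (hE : ∀ v, v ∈ E ↔ ∃ x, P x ∧ ∀ i, v i = s * (x i : ℝ)) {m : ℝ} {N : ℕ}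
    (hm : m = s ^ 2 * N) : shell E m = scaledShell P N s := by
  ext v
  rw [shell, Set.mem_inter_iff, hE, Finset.mem_coe]
  constructor
  · rintro ⟨⟨x, hPx, hxv⟩, hv⟩
    refine mem_scaledShell.2 ⟨x, ?_, hPx, hxv⟩
    rw [mem_normSphere_iff, hm] at hv
    simp_rw [hxv, mul_pow, ← Finset.mul_sum] at hv
    exact_mod_cast mul_left_cancel₀ (pow_ne_zero 2 hs) hv
  · intro hv
    obtain ⟨x, -, hPx, hxv⟩ := mem_scaledShell.1 hv
    exact ⟨⟨x, hPx, hxv⟩, hm ▸ mem_normSphere_of_mem_scaledShell hv⟩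

lemma smul_scaledShell (P : (Fin 16 → ℤ) → Prop) (N : ℕ) (s c : ℝ) :
    c • (scaledShell P N s : Set (EuclideanSpace ℝ (Fin 16))) = scaledShell P N (c * s) := by
  classical
  rw [scaledShell, scaledShell, Finset.coe_image, Finset.coe_image, ← Set.image_smul,
    Set.image_image]
  refine Set.image_congr fun x _ => ?_
  ext i
  simp [mul_assoc]

lemma mem_BW_iff_scaled (v : EuclideanSpace ℝ (Fin 16)) :
    v ∈ BW ↔ ∃ x, IsBW x ∧ ∀ i, v i = (√2)⁻¹ * (x i : ℝ) := by
  simp only [mem_BW_iff, div_eq_inv_mul]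

lemma mem_BW'_iff_scaled (v : EuclideanSpace ℝ (Fin 16)) :
    v ∈ BW' ↔ ∃ x, IsBWDual x ∧ ∀ i, v i = 2⁻¹ * (x i : ℝ) := by
  simp only [mem_BW'_iff, div_eq_inv_mul]

lemma unitShell_BW (m : ℕ) :
    unitShell BW m = scaledShell IsBW (2 * m) (√(2 * m : ℕ))⁻¹ := by
  rw [unitShell, shell_eq_scaledShell (N := 2 * m) (by positivity) mem_BW_iff_scaled (by
    rw [inv_pow, Real.sq_sqrt zero_le_two]; push_cast; ring), smul_scaledShell, Nat.cast_mul,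
    Real.sqrt_mul (by positivity), mul_inv, mul_comm (√(m : ℝ))⁻¹, Nat.cast_ofNat]

lemma unitShell_BW' (m : ℕ) :
    unitShell BW' m = scaledShell IsBWDual (4 * m) (√(4 * m : ℕ))⁻¹ := by
  have h4 : √4 = 2 := by rw [Real.sqrt_eq_iff_mul_self_eq] <;> norm_num
  rw [unitShell, shell_eq_scaledShell (N := 4 * m) (by positivity) mem_BW'_iff_scaled (by
    push_cast; ring), smul_scaledShell, Nat.cast_mul,
    Real.sqrt_mul (by positivity), mul_inv, mul_comm (√(m : ℝ))⁻¹, Nat.cast_ofNat, h4]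

lemma unitShell_union (A B : Set (EuclideanSpace ℝ (Fin 16))) (m : ℝ) :
    unitShell (A ∪ B) m = unitShell A m ∪ unitShell B m := by
  rw [unitShell, shell, Set.union_inter_distrib_right, Set.smul_set_union]
  rfl

/-- Two normalized shells have no common point if the product of the norms is not a square: the
ratio of proportional integral vectors is rational. -/
lemma disjoint_scaledShell (P Q : (Fin 16 → ℤ) → Prop) {M N : ℕ} (h : ¬ IsSquare (M * N)) :
    Disjoint (scaledShell P M (√M)⁻¹) (scaledShell Q N (√N)⁻¹) := by
  rw [Finset.disjoint_left]
  intro v hv hv'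
  obtain ⟨x, hx, -, hxv⟩ := mem_scaledShell.1 hv
  obtain ⟨y, -, -, hyv⟩ := mem_scaledShell.1 hv'
  have hM : M ≠ 0 := by rintro rfl; exact h (by simp)
  have hN : N ≠ 0 := by rintro rfl; exact h (by simp)
  obtain ⟨i, hi⟩ : ∃ i, x i ≠ 0 := by
    by_contra! h0
    simp only [h0] at hx
    simp at hx
    exact hM (by exact_mod_cast hx.symm)
  have h1 : (x i : ℝ) ^ 2 * N = (y i : ℝ) ^ 2 * M := by
    have h2 : ((√M)⁻¹ * (x i : ℝ)) ^ 2 = ((√N)⁻¹ * (y i : ℝ)) ^ 2 := by rw [← hxv, ← hyv]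
    rw [mul_pow, mul_pow, inv_pow, inv_pow, Real.sq_sqrt (Nat.cast_nonneg _),
      Real.sq_sqrt (Nat.cast_nonneg _)] at h2
    field_simp at h2
    linarith
  have h3 : (x i) ^ 2 * ((M * N : ℕ) : ℤ) = (y i * M) ^ 2 := by
    have h4 : (x i) ^ 2 * (N : ℤ) = (y i) ^ 2 * M := by exact_mod_cast h1
    push_cast
    linear_combination (M : ℤ) * h4
  obtain ⟨q, hq⟩ := (Int.pow_dvd_pow_iff two_ne_zero).1 (Dvd.intro _ h3)
  refine h ⟨q.natAbs, ?_⟩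
  have h5 : ((M * N : ℕ) : ℤ) = q ^ 2 := by
    refine mul_left_cancel₀ (pow_ne_zero 2 hi) ?_
    rw [h3, hq]; ring
  have h6 := congrArg Int.natAbs h5
  rwa [Int.natAbs_natCast, Int.natAbs_pow, sq] at h6

/-! ### Cubature formulas on several shells -/

/-- If a combination with positive coefficients of the moments of degree `2d` of the normalized
shells is proportional to those of the sphere, then the shells combine to a cubature formula. -/
lemma shellsCombine_of_moments {k d : ℕ} {E : Set (EuclideanSpace ℝ (Fin 16))} {m : Fin k → ℝ}
    (X : Fin k → Finset (EuclideanSpace ℝ (Fin 16))) (hX : ∀ j, unitShell E (m j) = X j)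
    (hsph : ∀ j, ∀ x ∈ X j, x ∈ normSphere 16 1) (hneg : ∀ j, ∀ x ∈ X j, -x ∈ X j)
    (hne : ∃ j, (X j).Nonempty) (w : Fin k → ℝ) (hw : ∀ j, 0 < w j)
    (hmom : ∃ c : ℝ, ∀ a : Fin 16 → ℕ, ∑ i, a i = 2 * d →
      ∑ j, w j * ∑ x ∈ X j, ∏ i, x i ^ a i = c * ∏ i, (evenFactor (a i) : ℝ)) :
    ShellsCombine (2 * d + 1) E m := by
  classical
  set T : ℝ := ∑ j, w j * (X j).card with hT
  have hT0 : 0 < T := by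
    obtain ⟨j, hj⟩ := hne
    refine Finset.sum_pos' (fun j _ => mul_nonneg (hw j).le (Nat.cast_nonneg _))
      ⟨j, Finset.mem_univ j, mul_pos (hw j) (Nat.cast_pos.2 hj.card_pos)⟩
  have hmem : ∀ j x, x ∈ unitShell E (m j) ↔ x ∈ X j := fun j x => by rw [hX, Finset.mem_coe]
  have hsupp : shellSupport E m = (Finset.univ.biUnion X : Finset _) := by
    ext x
    simp [shellSupport, hX]
  have hind : ∀ j (x : EuclideanSpace ℝ (Fin 16)),
      (unitShell E (m j)).indicator (fun _ => T⁻¹ * w j) x =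
        if x ∈ X j then T⁻¹ * w j else 0 := fun j x => by
    rw [Set.indicator_apply]
    simp only [hmem]
  have hsum : ∀ f : EuclideanSpace ℝ (Fin 16) → ℝ,
      ∑ x ∈ Finset.univ.biUnion X, shellWeight E m (fun j => T⁻¹ * w j) x * f x =
        T⁻¹ * ∑ j, w j * ∑ x ∈ X j, f x := fun f => by
    simp_rw [shellWeight, Finset.sum_mul]
    rw [Finset.sum_comm, Finset.mul_sum]
    refine Finset.sum_congr rfl fun j _ => ?_
    simp_rw [hind, ite_mul, zero_mul]
    rw [← Finset.sum_filter, Finset.filter_mem_eq_inter, Finset.inter_eq_right.2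
      (Finset.subset_biUnion_of_mem X (Finset.mem_univ j)), ← Finset.mul_sum, mul_assoc]
  refine ⟨fun j => T⁻¹ * w j, fun j => mul_pos (inv_pos.2 hT0) (hw j), ?_⟩
  rw [hsupp]
  refine isCubatureFormula_of_moments one_pos d _ _ ?_ ?_ ?_ ?_ ?_ ?_
  · intro x hx
    obtain ⟨j, -, hj⟩ := Finset.mem_biUnion.1 hx
    exact hsph j x hj
  · intro x hx
    obtain ⟨j, -, hj⟩ := Finset.mem_biUnion.1 hx
    refine Finset.sum_pos' (fun j _ => ?_) ⟨j, Finset.mem_univ j, ?_⟩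
    · exact Set.indicator_nonneg (fun _ _ => (mul_pos (inv_pos.2 hT0) (hw j)).le) _
    · rw [hind, if_pos hj]
      exact mul_pos (inv_pos.2 hT0) (hw j)
  · intro x hx
    obtain ⟨j, -, hj⟩ := Finset.mem_biUnion.1 hx
    exact Finset.mem_biUnion.2 ⟨j, Finset.mem_univ j, hneg j x hj⟩
  · intro x _
    refine Finset.sum_congr rfl fun j _ => ?_
    have hiff : -x ∈ X j ↔ x ∈ X j :=
      ⟨fun h => by simpa using hneg j _ h, fun h => hneg j x h⟩
    rw [hind, hind]
    simp only [hiff]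
  · have h := hsum fun _ => 1
    simp only [mul_one, Finset.sum_const, nsmul_eq_mul] at h
    rw [h, ← hT, inv_mul_cancel₀ hT0.ne']
  · obtain ⟨c, hc⟩ := hmom
    refine ⟨T⁻¹ * c, fun a ha => ?_⟩
    rw [hsum, hc a ha, mul_assoc]

lemma ncard_shellSupport {k : ℕ} {E : Set (EuclideanSpace ℝ (Fin 16))} {m : Fin k → ℝ}
    (X : Fin k → Finset (EuclideanSpace ℝ (Fin 16))) (hX : ∀ j, unitShell E (m j) = X j)
    (hdisj : ∀ i j, i ≠ j → Disjoint (X i) (X j)) :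
    (shellSupport E m).ncard = ∑ j, (X j).card := by
  classical
  have hsupp : shellSupport E m = (Finset.univ.biUnion X : Finset _) := by
    ext x
    simp [shellSupport, hX]
  rw [hsupp, Set.ncard_coe_finset, Finset.card_biUnion fun i _ j _ => hdisj i j]

lemma sum_normalized_shell (P : (Fin 16 → ℤ) → Prop) {N d : ℕ} (hN : N ≠ 0) {a : Fin 16 → ℕ}
    (ha : ∑ i, a i = 2 * d) :
    ∑ x ∈ scaledShell P N (√N)⁻¹, ∏ i, x i ^ a i = moment P N a / N ^ d := by
  have hN0 : (0 : ℝ) < N := Nat.cast_pos.2 (Nat.pos_of_ne_zero hN)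
  rw [sum_scaledShell P N (by positivity), ha, pow_mul, inv_pow, Real.sq_sqrt hN0.le, inv_pow]
  ring

lemma mem_normSphere_one {P : (Fin 16 → ℤ) → Prop} {N : ℕ} (hN : N ≠ 0)
    {x : EuclideanSpace ℝ (Fin 16)} (hx : x ∈ scaledShell P N (√N)⁻¹) : x ∈ normSphere 16 1 := by
  have hN0 : (0 : ℝ) < N := Nat.cast_pos.2 (Nat.pos_of_ne_zero hN)
  have h := mem_normSphere_of_mem_scaledShell hx
  rwa [inv_pow, Real.sq_sqrt hN0.le, inv_mul_cancel₀ hN0.ne'] at h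

/-- The normalized shell `m` of the Barnes-Wall lattice. -/
def primalShell (m : ℕ) : Finset (EuclideanSpace ℝ (Fin 16)) :=
  scaledShell IsBW (2 * m) (√(2 * m : ℕ))⁻¹

/-- The normalized shell `m` of the rescaled dual lattice. -/
def dualShell (m : ℕ) : Finset (EuclideanSpace ℝ (Fin 16)) :=
  scaledShell IsBWDual (4 * m) (√(4 * m : ℕ))⁻¹

open Classical in
/-- The normalized shell `m` of the union of the two lattices. -/
def unionShell (m : ℕ) : Finset (EuclideanSpace ℝ (Fin 16)) := primalShell m ∪ dualShell m

lemma unitShell_BW_union (m : ℕ) : unitShell (BW ∪ BW') m = unionShell m := by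
  classical
  rw [unitShell_union, unitShell_BW, unitShell_BW', unionShell, Finset.coe_union]
  rfl

lemma disjoint_primalShell_dualShell {m n : ℕ} (h : ¬ IsSquare (2 * m * (4 * n))) :
    Disjoint (primalShell m) (dualShell n) := disjoint_scaledShell _ _ h

lemma not_isSquare_mul_self_mul {c k : ℕ} (hc : c ≠ 0) (hk : ¬ IsSquare k) :
    ¬ IsSquare (c * c * k) := by
  rintro ⟨q, hq⟩
  obtain ⟨s, rfl⟩ : c ∣ q := by
    rw [← Nat.pow_dvd_pow_iff two_ne_zero, sq, sq]
    exact Dvd.intro _ hq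
  exact hk ⟨s, mul_left_cancel₀ (mul_ne_zero hc hc) (hq.trans (by ring))⟩

lemma disjoint_primalShell {m n : ℕ} (h : ¬ IsSquare (m * n)) :
    Disjoint (primalShell m) (primalShell n) := by
  refine disjoint_scaledShell _ _ ?_
  convert not_isSquare_mul_self_mul two_ne_zero h using 2; ring

lemma disjoint_unionShell {m n : ℕ} (h1 : ¬ IsSquare (m * n)) (h2 : ¬ IsSquare (2 * (m * n))) :
    Disjoint (unionShell m) (unionShell n) := by
  have h24 := not_isSquare_mul_self_mul two_ne_zero h2
  have h44 := not_isSquare_mul_self_mul four_ne_zero h1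
  rw [unionShell, unionShell, Finset.disjoint_union_left, Finset.disjoint_union_right,
    Finset.disjoint_union_right]
  refine ⟨⟨disjoint_primalShell h1, disjoint_scaledShell _ _ ?_⟩,
    disjoint_scaledShell _ _ ?_, disjoint_scaledShell _ _ ?_⟩
  · convert h24 using 2; ring
  · convert h24 using 2; ring
  · convert h44 using 2; ring

lemma sqrt_cast_inv_ne_zero {N : ℕ} (hN : N ≠ 0) : (√(N : ℝ))⁻¹ ≠ 0 := by positivity

lemma card_primalShell {m v : ℕ} (hm : m ≠ 0) (h40 : 2 * m ≤ 40)
    (h : kronDigit (2 * m) (bwGen fun _ => 0) = 2 * v) : (primalShell m).card = v := by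
  have h1 := card_scaledShell IsBW (2 * m) (sqrt_cast_inv_ne_zero (N := 2 * m) (by omega))
  rw [moment_zero_of_digit h40 h] at h1
  exact_mod_cast h1

lemma card_dualShell {m v : ℕ} (hm : m ≠ 0) (h40 : 4 * m ≤ 40)
    (h : kronDigit (4 * m) (dualGen fun _ => 0) = 32 * v) : (dualShell m).card = v := by
  have h1 := card_scaledShell IsBWDual (4 * m) (sqrt_cast_inv_ne_zero (N := 4 * m) (by omega))
  rw [moment_dual_zero_of_digit h40 h] at h1
  exact_mod_cast h1

lemma not_isSquare_dual {m : ℕ} (hm : m ≠ 0) : ¬ IsSquare (2 * m * (4 * m)) := by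
  rintro ⟨q, hq⟩
  have h2 : (q : ℝ) / (2 * m) = √2 := by
    have hm0 : (m : ℝ) ≠ 0 := Nat.cast_ne_zero.2 hm
    have hq' : (2 * m * (4 * m) : ℝ) = q * q := by exact_mod_cast hq
    refine ((Real.sqrt_eq_iff_mul_self_eq zero_le_two (by positivity)).2 ?_).symm
    field_simp
    linarith
  exact irrational_sqrt_two ⟨q / (2 * m), by push_cast; exact h2⟩

lemma card_primalShell_four : (primalShell 4).card = 4320 :=
  card_primalShell (by norm_num) (by norm_num) (by decide +kernel)

lemma card_primalShell_six : (primalShell 6).card = 61440 :=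
  card_primalShell (by norm_num) (by norm_num) (by decide +kernel)

lemma card_unionShell {m v : ℕ} (hm : m ≠ 0)
    (h : (primalShell m).card = v) (h' : (dualShell m).card = v) :
    (unionShell m).card = 2 * v := by
  classical
  rw [unionShell, Finset.card_union_of_disjoint
    (disjoint_primalShell_dualShell (not_isSquare_dual hm)), h, h', two_mul]

lemma card_unionShell_four : (unionShell 4).card = 8640 :=
  card_unionShell (v := 4320) (by norm_num) card_primalShell_four
    (card_dualShell (by norm_num) (by norm_num) (by decide +kernel))

lemma card_unionShell_six : (unionShell 6).card = 122880 :=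
  card_unionShell (v := 61440) (by norm_num) card_primalShell_six
    (card_dualShell (by norm_num) (by norm_num) (by decide +kernel))

lemma card_unionShell_ten : (unionShell 10).card = 4423680 :=
  card_unionShell (v := 2211840) (by norm_num)
    (card_primalShell (by norm_num) (by norm_num) (by decide +kernel))
    (card_dualShell (by norm_num) (by norm_num) (by decide +kernel))

lemma sum_primalShell {m d : ℕ} (hm : m ≠ 0) {a : Fin 16 → ℕ} (ha : ∑ i, a i = 2 * d) :
    (m : ℝ) ^ d * ∑ x ∈ primalShell m, ∏ i, x i ^ a i = moment IsBW (2 * m) a / 2 ^ d := by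
  have hm0 : (m : ℝ) ≠ 0 := Nat.cast_ne_zero.2 hm
  rw [primalShell, sum_normalized_shell _ (by omega) ha, Nat.cast_mul, mul_pow]
  push_cast
  field_simp

lemma sum_dualShell {m d : ℕ} (hm : m ≠ 0) {a : Fin 16 → ℕ} (ha : ∑ i, a i = 2 * d) :
    (m : ℝ) ^ d * ∑ x ∈ dualShell m, ∏ i, x i ^ a i = moment IsBWDual (4 * m) a / 4 ^ d := by
  have hm0 : (m : ℝ) ≠ 0 := Nat.cast_ne_zero.2 hm
  rw [dualShell, sum_normalized_shell _ (by omega) ha, Nat.cast_mul, mul_pow]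
  push_cast
  field_simp

lemma sum_unionShell {m d : ℕ} (hm : m ≠ 0) {a : Fin 16 → ℕ} (ha : ∑ i, a i = 2 * d) :
    (m : ℝ) ^ d * ∑ x ∈ unionShell m, ∏ i, x i ^ a i =
      (2 ^ d * moment IsBW (2 * m) a + moment IsBWDual (4 * m) a) / 4 ^ d := by
  classical
  rw [unionShell, Finset.sum_union (disjoint_primalShell_dualShell (not_isSquare_dual hm)),
    mul_add, sum_primalShell hm ha, sum_dualShell hm ha, add_div,
    show (4 : ℝ) ^ d = 2 ^ d * 2 ^ d by rw [← mul_pow]; norm_num]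
  field_simp

lemma neg_mem_primalShell {m : ℕ} {x : EuclideanSpace ℝ (Fin 16)} (hx : x ∈ primalShell m) :
    -x ∈ primalShell m := neg_mem_scaledShell (fun _ h => h.neg) hx

lemma neg_mem_unionShell {m : ℕ} {x : EuclideanSpace ℝ (Fin 16)} (hx : x ∈ unionShell m) :
    -x ∈ unionShell m := by
  classical
  exact Finset.mem_union.2 ((Finset.mem_union.1 hx).imp neg_mem_primalShell
    (neg_mem_scaledShell fun _ h => h.neg))

lemma mem_normSphere_of_mem_unionShell {m : ℕ} (hm : m ≠ 0) {x : EuclideanSpace ℝ (Fin 16)}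
    (hx : x ∈ unionShell m) : x ∈ normSphere 16 1 := by
  classical
  exact (Finset.mem_union.1 hx).elim (mem_normSphere_one (by omega)) (mem_normSphere_one (by omega))

/-! ### The designs and the cubature formulas -/

/-- The moments of degree `6` of a shell are proportional to those of the sphere by `moment_six`,
hence the strength is `7`. -/
theorem isSphericalDesign_shell_BW {m : ℝ} (hm : 0 < m) (hne : (shell BW m).Nonempty) :
    IsSphericalDesign 7 m (shell BW m) := by
  have hs : (√2)⁻¹ ≠ (0 : ℝ) := by positivity
  have hs2 : ((√2)⁻¹ : ℝ) ^ 2 = 2⁻¹ := by rw [inv_pow, Real.sq_sqrt zero_le_two]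
  obtain ⟨v, hvB, hv⟩ := hne
  obtain ⟨x, -, hxv⟩ := (mem_BW_iff_scaled v).1 hvB
  obtain ⟨N, hN⟩ : ∃ N : ℕ, m = ((√2)⁻¹) ^ 2 * (N : ℝ) := by
    refine ⟨(∑ i, x i ^ 2).toNat, ?_⟩
    have h0 : ((∑ i, x i ^ 2).toNat : ℤ) = ∑ i, x i ^ 2 :=
      Int.toNat_of_nonneg (Finset.sum_nonneg fun i _ => sq_nonneg _)
    rw [← Int.cast_natCast, h0, ← mem_normSphere_iff.1 hv]
    simp_rw [hxv, mul_pow, ← Finset.mul_sum]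
    push_cast
    rfl
  have hshell := shell_eq_scaledShell hs mem_BW_iff_scaled hN
  set X := scaledShell IsBW N (√2)⁻¹ with hX
  have hX0 : (X.card : ℝ) ≠ 0 := by
    have hvX : v ∈ X := Finset.mem_coe.1 (hshell ▸ ⟨hvB, hv⟩ : v ∈ (X : Set _))
    exact Nat.cast_ne_zero.2 (Finset.card_ne_zero_of_mem hvX)
  rw [IsSphericalDesign, hshell, Set.ncard_coe_finset]
  refine isCubatureFormula_of_moments hm 3 X _ ?_ ?_ ?_ ?_ ?_ ?_
  · intro x hx
    rw [hN]
    exact mem_normSphere_of_mem_scaledShell hx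
  · intro x _
    positivity
  · intro x hx
    exact neg_mem_scaledShell (fun _ h => h.neg) hx
  · intro x _
    rfl
  · rw [Finset.sum_const, nsmul_eq_mul, mul_inv_cancel₀ hX0]
  · obtain ⟨c, hc⟩ := moment_six N
    refine ⟨(X.card : ℝ)⁻¹ * ((√2)⁻¹) ^ 6 * c / 8, fun a ha => ?_⟩
    rw [← Finset.mul_sum, sum_scaledShell _ _ hs, ha]
    have h : (8 : ℝ) * moment IsBW N a = c * ∏ i, (evenFactor (a i) : ℝ) := by
      exact_mod_cast hc a ha
    linear_combination (X.card : ℝ)⁻¹ * ((√2)⁻¹) ^ 6 / 8 * h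

theorem ncard_shell_BW_four : (shell BW 4).ncard = 4320 := by
  rw [shell_eq_scaledShell (s := (√2)⁻¹) (N := 8) (by positivity) mem_BW_iff_scaled (by
    rw [inv_pow, Real.sq_sqrt zero_le_two]; norm_num), Set.ncard_coe_finset]
  have h := card_scaledShell IsBW 8 (s := (√2)⁻¹) (by positivity)
  rw [moment_zero_of_digit (v := 4320) (by norm_num) (by decide +kernel)] at h
  exact_mod_cast h

/-- With coefficients `w j` for the integral vectors, the coefficient of the normalized shell is
`w j * m j ^ d`. -/
lemma shellsCombine_BW {k d : ℕ} (m : Fin k → ℕ) (hm : ∀ j, m j ≠ 0)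
    (hne : ∃ j, (primalShell (m j)).Nonempty) (w : Fin k → ℝ) (hw : ∀ j, 0 < w j)
    (hmom : ∃ c : ℝ, ∀ a : Fin 16 → ℕ, ∑ i, a i = 2 * d →
      ∑ j, w j * moment IsBW (2 * m j) a = c * ∏ i, (evenFactor (a i) : ℝ)) :
    ShellsCombine (2 * d + 1) BW fun j => (m j : ℝ) := by
  refine shellsCombine_of_moments (fun j => primalShell (m j)) (fun j => unitShell_BW (m j))
    (fun j x hx => mem_normSphere_one (mul_ne_zero two_ne_zero (hm j)) hx)
    (fun j x hx => neg_mem_primalShell hx) hne (fun j => w j * (m j : ℝ) ^ d)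
    (fun j => mul_pos (hw j) (pow_pos (Nat.cast_pos.2 (Nat.pos_of_ne_zero (hm j))) d)) ?_
  obtain ⟨c, hc⟩ := hmom
  refine ⟨c / 2 ^ d, fun a ha => ?_⟩
  simp_rw [mul_assoc, fun j => sum_primalShell (hm j) ha, ← mul_div_assoc]
  rw [← Finset.sum_div, hc a ha]
  ring

lemma shellsCombine_union {k d : ℕ} (m : Fin k → ℕ) (hm : ∀ j, m j ≠ 0)
    (hne : ∃ j, (primalShell (m j)).Nonempty) (w : Fin k → ℝ) (hw : ∀ j, 0 < w j)
    (hmom : ∃ c : ℝ, ∀ a : Fin 16 → ℕ, ∑ i, a i = 2 * d →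
      ∑ j, w j * (2 ^ d * moment IsBW (2 * m j) a + moment IsBWDual (4 * m j) a) =
        c * ∏ i, (evenFactor (a i) : ℝ)) :
    ShellsCombine (2 * d + 1) (BW ∪ BW') fun j => (m j : ℝ) := by
  classical
  refine shellsCombine_of_moments (fun j => unionShell (m j)) (fun j => unitShell_BW_union (m j))
    (fun j x hx => mem_normSphere_of_mem_unionShell (hm j) hx)
    (fun j x hx => neg_mem_unionShell hx) (hne.imp fun j hj => hj.mono Finset.subset_union_left)
    (fun j => w j * (m j : ℝ) ^ d)
    (fun j => mul_pos (hw j) (pow_pos (Nat.cast_pos.2 (Nat.pos_of_ne_zero (hm j))) d)) ?_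
  obtain ⟨c, hc⟩ := hmom
  refine ⟨c / 4 ^ d, fun a ha => ?_⟩
  simp_rw [mul_assoc, fun j => sum_unionShell (hm j) ha, ← mul_div_assoc]
  rw [← Finset.sum_div, hc a ha]
  ring

lemma primalShell_four_nonempty : (primalShell 4).Nonempty := by
  rw [← Finset.card_pos, card_primalShell_four]
  exact Nat.succ_pos _

lemma cast_pair : (fun j => ((![4, 6] : Fin 2 → ℕ) j : ℝ)) = ![4, 6] := by
  ext j
  fin_cases j <;> simp

lemma cast_triple : (fun j => ((![4, 6, 10] : Fin 3 → ℕ) j : ℝ)) = ![4, 6, 10] := by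
  ext j
  fin_cases j <;> simp

theorem shellsCombine_nine : ShellsCombine 9 BW ![4, 6] := by
  rw [← cast_pair]
  refine shellsCombine_BW (d := 4) _ (by decide) ⟨0, primalShell_four_nonempty⟩ ![16, 1]
    (by simp [Fin.forall_fin_two]) ⟨768, fun a ha => ?_⟩
  -- `shortMoment 4` contains the factor `2 ^ 4`, whence `768 = 12288 / 16`.
  have h := congrArg (Int.cast (R := ℝ)) (shortMoment_eight a ha)
  simp [shortMoment] at h
  simp
  linear_combination h / 16

theorem shellsCombine_eleven : ShellsCombine 11 (BW ∪ BW') ![4, 6] := by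
  rw [← cast_pair]
  refine shellsCombine_union (d := 5) _ (by decide) ⟨0, primalShell_four_nonempty⟩ ![24, 1]
    (by simp [Fin.forall_fin_two]) ⟨12288, fun a ha => ?_⟩
  have h := congrArg (Int.cast (R := ℝ)) (shortMoment_ten a ha)
  simp [shortMoment] at h
  simp
  linear_combination h

theorem shellsCombine_thirteen : ShellsCombine 13 (BW ∪ BW') ![4, 6, 10] := by
  rw [← cast_triple]
  refine shellsCombine_union (d := 6) _ (by decide) ⟨0, primalShell_four_nonempty⟩
    ![2560, 60, 1] (by simp [Fin.forall_fin_succ]) ⟨3932160, fun a ha => ?_⟩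
  have h := congrArg (Int.cast (R := ℝ)) (shortMoment_twelve a ha)
  simp [shortMoment] at h
  simp [Fin.sum_univ_three]
  linear_combination h

lemma ncard_shellSupport_BW {k : ℕ} (m : Fin k → ℕ)
    (h : ∀ i j, i ≠ j → ¬ IsSquare (m i * m j)) :
    (shellSupport BW fun j => (m j : ℝ)).ncard = ∑ j, (primalShell (m j)).card :=
  ncard_shellSupport _ (fun j => unitShell_BW (m j)) fun i j hij => disjoint_primalShell (h i j hij)

lemma ncard_shellSupport_union {k : ℕ} (m : Fin k → ℕ)
    (h : ∀ i j, i ≠ j → ¬ IsSquare (m i * m j) ∧ ¬ IsSquare (2 * (m i * m j))) :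
    (shellSupport (BW ∪ BW') fun j => (m j : ℝ)).ncard = ∑ j, (unionShell (m j)).card :=
  ncard_shellSupport _ (fun j => unitShell_BW_union (m j)) fun i j hij =>
    disjoint_unionShell (h i j hij).1 (h i j hij).2

/-- Here and in `sum_triple_eq` the numbers of points are variables, which avoids the evaluation of
explicit cardinalities by enumeration. -/
lemma sum_pair_eq {f : ℕ → ℕ} {a b c : ℕ} (h4 : f 4 = a) (h6 : f 6 = b) (h : a + b = c) :
    ∑ j : Fin 2, f (![4, 6] j) = c :=
  (Fin.sum_univ_two _).trans ((congrArg₂ (· + ·) h4 h6).trans h)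

lemma sum_triple_eq {f : ℕ → ℕ} {a b b' c : ℕ} (h4 : f 4 = a) (h6 : f 6 = b) (h10 : f 10 = b')
    (h : a + b + b' = c) : ∑ j : Fin 3, f (![4, 6, 10] j) = c :=
  (Fin.sum_univ_three _).trans
    ((congrArg₂ (· + ·) (congrArg₂ (· + ·) h4 h6) h10).trans h)

theorem ncard_shellSupport_BW_pair : (shellSupport BW ![4, 6]).ncard = 65760 := by
  rw [← cast_pair, ncard_shellSupport_BW ![4, 6] (by decide +kernel)]
  exact sum_pair_eq (f := fun n => (primalShell n).card) card_primalShell_four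
    card_primalShell_six rfl

theorem ncard_shellSupport_union_pair : (shellSupport (BW ∪ BW') ![4, 6]).ncard = 131520 := by
  rw [← cast_pair, ncard_shellSupport_union ![4, 6] (by decide +kernel)]
  exact sum_pair_eq (f := fun n => (unionShell n).card) card_unionShell_four card_unionShell_six rfl

theorem ncard_shellSupport_union_triple :
    (shellSupport (BW ∪ BW') ![4, 6, 10]).ncard = 4555200 := by
  rw [← cast_triple, ncard_shellSupport_union ![4, 6, 10] (by decide +kernel)]
  exact sum_triple_eq (f := fun n => (unionShell n).card) card_unionShell_four card_unionShell_six
    card_unionShell_ten rfl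

end SphericalCubature

end

theorem mainTheorem4 :
    -- every shell of `BW₁₆` is a spherical 7-design; the first one has 4320 points
    (∀ m : ℝ, 0 < m → (SphericalCubature.shell SphericalCubature.BW m).Nonempty →
      SphericalCubature.IsSphericalDesign 7 m
        (SphericalCubature.shell SphericalCubature.BW m)) ∧
    (SphericalCubature.shell SphericalCubature.BW 4).ncard = 4320 ∧
    -- shells 4 and 6 of `BW₁₆`: strength 9
    SphericalCubature.ShellsCombine 9 SphericalCubature.BW ![4, 6] ∧
    (SphericalCubature.shellSupport SphericalCubature.BW ![4, 6]).ncard = 65760 ∧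
    -- shells 4 and 6 of `BW₁₆ ∪ BW₁₆'`: strength 11
    SphericalCubature.ShellsCombine 11
      (SphericalCubature.BW ∪ SphericalCubature.BW') ![4, 6] ∧
    (SphericalCubature.shellSupport
      (SphericalCubature.BW ∪ SphericalCubature.BW') ![4, 6]).ncard = 131520 ∧
    -- shells 4, 6 and 10 of `BW₁₆ ∪ BW₁₆'`: strength 13
    SphericalCubature.ShellsCombine 13
      (SphericalCubature.BW ∪ SphericalCubature.BW') ![4, 6, 10] ∧
    (SphericalCubature.shellSupport
      (SphericalCubature.BW ∪ SphericalCubature.BW') ![4, 6, 10]).ncard = 4555200 := by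
  exact ⟨fun _ hm hne => SphericalCubature.isSphericalDesign_shell_BW hm hne,
    SphericalCubature.ncard_shell_BW_four, SphericalCubature.shellsCombine_nine,
    SphericalCubature.ncard_shellSupport_BW_pair, SphericalCubature.shellsCombine_eleven,
    SphericalCubature.ncard_shellSupport_union_pair, SphericalCubature.shellsCombine_thirteen,
    SphericalCubature.ncard_shellSupport_union_triple⟩
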